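/- Let $g\in C^2(\mathbb R)$ and $a\in(0,1)$ satisfy $g(0)=g(a)=g(1)=0$, $g'(0)<0$, $g'(1)<0$, $g>0$ on $(-\infty,0)\cup(a,1)$ and $g<0$ on $(0,a)\cup(1,\infty)$. Let $c\neq0$ and $\Phi\in C^1(\mathbb R,\mathbb R)$ satisfy $$-c\,\Phi'(\xi)=\Phi(\xi+1)+\Phi(\xi-1)-2\Phi(\xi)+g(\Phi(\xi))\quad(\xi\in\mathbb R),\qquad \lim_{\xi\to-\infty}\Phi(\xi)=0,\quad \lim_{\xi\to+\infty}\Phi(\xi)=1,\quad \Phi(0)=\tfrac12 .$$ Let $u^0\in\ell^\infty(\mathbb Z^2)$ satisfy $$\limsup_{i\to-\infty}\,\sup_{j\in\mathbb Z}u^0_{i,j}<a<\liminf_{i\to\infty}\,\inf_{j\in\mathbb Z}u^0_{i,j},$$ and let $u\in C^1([0,\infty);\ell^\infty(\mathbb Z^2))$ satisfy $u(0)=u^0$ and, for all $t>0$ and $(i,j)\in\mathbb Z^2$, $$\dot u_{i,j}=u_{i+1,j}+u_{i-1,j}+u_{i,j+1}+u_{i,j-1}-4u_{i,j}+g(u_{i,j}).$$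 Then there is a time $T>0$ with the following properties. (1) For every $j\in\mathbb Z$ and $t\ge T$ there is a unique $i_*=i_*(j,t)\in\mathbb Z$ with $0<u_{i_*,j}(t)\le\frac12$ and $u_{i_*+1,j}(t)>\frac12$. (2) For every $j\in\mathbb Z$ and $t\ge T$ there is $i\in\mathbb Z$ with $\Phi(-2)<u_{i,j}(t)\le\frac12$. (3) There is $\delta>0$ such that $u_{i+1,j}(t)-u_{i,j}(t)\ge\delta$ for all $t\ge T$ and all $(i,j)\in\mathbb Z^2$ with $\Phi(-2)\le u_{i,j}(t)\le\Phi(2)$. (4) If $t\ge T$ and $u_{i,j}(t)\le\Phi(-2)$, then $u_{i-1,j}(t)\le\Phi(-2)$. (5) If $t\ge T$ and $u_{i,j}(t)\ge\Phi(2)$, then $u_{i+1,j}(t)\ge\Phi(2)$. -/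

import Mathlib

open Filter Topology
open scoped ENNReal

/-- The Banach space `ℓ^∞(ℤ²)` of bounded real functions on the planar lattice, with the sup norm. -/
abbrev LInfLattice : Type := lp (fun _ : ℤ × ℤ => ℝ) ∞

/-- The five-point discrete Laplacian on `ℤ²`. -/
def discreteLaplacian (v : ℤ × ℤ → ℝ) (i j : ℤ) : ℝ :=
  v (i + 1, j) + v (i, j + 1) + v (i - 1, j) + v (i, j - 1) - 4 * v (i, j)

/-- The bistability condition on the nonlinearity `g`, with unstable zero `a`. -/
structure IsBistable (g : ℝ → ℝ) (a : ℝ) : Prop where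
  contDiff : ContDiff ℝ 2 g
  a_pos : 0 < a
  a_lt_one : a < 1
  map_zero : g 0 = 0
  map_a : g a = 0
  map_one : g 1 = 0
  deriv_zero_neg : deriv g 0 < 0
  deriv_one_neg : deriv g 1 < 0
  pos_of_neg : ∀ x, x < 0 → 0 < g x
  neg_of_lt_a : ∀ x, 0 < x → x < a → g x < 0
  pos_of_a_lt : ∀ x, a < x → x < 1 → 0 < g x
  neg_of_one_lt : ∀ x, 1 < x → g x < 0

/-- `(Φ, c)` is a horizontal travelling front with nonzero speed: `(i, j, t) ↦ Φ (i - c t)` solves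
the lattice equation and `Φ` connects `0` to `1`; the translate is fixed by `Φ 0 = 1/2`. -/
structure IsTravellingFront (g : ℝ → ℝ) (c : ℝ) (Φ : ℝ → ℝ) : Prop where
  speed_ne_zero : c ≠ 0
  contDiff : ContDiff ℝ 1 Φ
  tendsto_atBot : Tendsto Φ atBot (𝓝 0)
  tendsto_atTop : Tendsto Φ atTop (𝓝 1)
  wave_eq : ∀ ξ : ℝ, -c * deriv Φ ξ = Φ (ξ + 1) + Φ (ξ - 1) - 2 * Φ ξ + g (Φ ξ)
  map_zero : Φ 0 = 1 / 2

/-- The initial condition is front-like, uniformly in `j`. As `u₀` is bounded, the suprema,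
infima and limits below are those of bounded families of reals. -/
structure IsFrontLike (a : ℝ) (u₀ : LInfLattice) : Prop where
  limsup_lt : limsup (fun i : ℤ => ⨆ j : ℤ, u₀ (i, j)) atBot < a
  lt_liminf : a < liminf (fun i : ℤ => ⨅ j : ℤ, u₀ (i, j)) atTop

/-- `u ∈ C¹([0, ∞); ℓ^∞(ℤ²))` solves the discrete Allen-Cahn equation for `t > 0` with initial
condition `u₀`. Only the values of `u` on `[0, ∞)` matter. -/
structure IsAllenCahnSolution (g : ℝ → ℝ) (u₀ : LInfLattice) (u : ℝ → LInfLattice) : Prop where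
  contDiffOn : ContDiffOn ℝ 1 u (Set.Ici 0)
  lattice_eq : ∀ t : ℝ, 0 < t → ∀ i j : ℤ,
    HasDerivAt (fun s => u s (i, j)) (discreteLaplacian (u t) i j + g (u t (i, j))) t
  initial : u 0 = u₀

/-- The interfacial region `{(i, j) : Φ(-2) ≤ v i j ≤ Φ(2)}` of a lattice function `v`. -/
def interfacialRegion (Φ : ℝ → ℝ) (v : ℤ × ℤ → ℝ) : Set (ℤ × ℤ) :=
  {p | Φ (-2) ≤ v p ∧ v p ≤ Φ 2}

/-! At large times the solution looks, near its interface, like a translate of the strictly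
increasing profile `Φ`, uniformly over the sites there. All the claims are read off from this, and
two mechanisms produce it.

Barriers. Comparison with constants, affine functions of time and exponentials brings the solution
below `1 + q` everywhere and below `q` on the far left. The Fife-McLeod supersolution
(`IsTravellingFront.exists_supersolution`) then keeps it under a translate of `Φ (i - c t)` plus a
decaying error. The symmetry `x ↦ 1 - x`, `i ↦ -i` turns upper bounds into lower ones. Hence
`EventuallyFrontLike`: for each tolerance, the transition from `0` to `1` takes place within a
bounded distance of `c t`, uniformly in `j`.

Rigidity. Recentre the solution at points near the interface and at times tending to infinity. The
limits are entire solutions with uniform tails (`IsFront`), and by the Liouville theorem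
`IsFront.exists_eq_translate` each is a translate of `Φ`. That theorem rests on sliding
(`IsFront.exists_touching`): shift one front to the first position from which it dominates another.
As `g` decreases near `0` and `1`, contact cannot escape into the tails, so the two touch after a
recentred limit, and the strong maximum principle makes these limits coincide in the past. Applied
to a front and its own shifts, this gives planarity and monotonicity; applied to `Φ` and another
front, uniqueness.

Compactness then gives `IsForward.exists_translate_near`, and from it `IsForward.exists_increase`:
to the right of a value at least `y`, with `y` in `[Φ (-2), Φ 2]`, there is a value at least `y +
δ`. The choices of `y` as `1/2`, the value itself, `Φ (-2)` and `Φ 2` give the crossing,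
monotonicity, lower and upper boundary claims. -/

/-- The five-point Laplacian of a space-time function on `ℤ² × ℝ`. -/
def lap (W : ℤ → ℤ → ℝ → ℝ) (i j : ℤ) (t : ℝ) : ℝ :=
  W (i + 1) j t + W i (j + 1) t + W (i - 1) j t + W i (j - 1) t - 4 * W i j t

/-- `W` solves the lattice equation for all (positive and negative) times. -/
def IsEntire (g : ℝ → ℝ) (W : ℤ → ℤ → ℝ → ℝ) : Prop :=
  ∀ i j t, HasDerivAt (W i j) (lap W i j t + g (W i j t)) t

/-! ### Weak maximum principle on a bounded time interval -/

/-- With the integrating factor `exp ((4 + B) t)`, the neighbours and the `B`-terms push `D` down at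
rate at most `(4 + 2B) m exp ((4 + 4B) t)`. Integration divides by `8 + 5B = (4 + B) + (4 + 4B)`,
and `(4 + 2B) / (8 + 5B) ≤ 1/2`. Iterating the halving replaces a search for a minimum, which need
not be attained on the infinite lattice. -/
lemma neg_half_bound_of_neg_bound {D D' : ℤ → ℤ → ℝ → ℝ} {B T m : ℝ} (hB : 0 ≤ B) (hm : 0 ≤ m)
    (hcont : ∀ i j, ContinuousOn (D i j) (Set.Icc 0 T))
    (hder : ∀ i j, ∀ t ∈ Set.Ioo 0 T, HasDerivAt (D i j) (D' i j t) t)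
    (hineq : ∀ i j, ∀ t ∈ Set.Ioo 0 T, lap D i j t - B * |D i j t| ≤ D' i j t)
    (h0 : ∀ i j, 0 ≤ D i j 0)
    (hb : ∀ i j, ∀ t ∈ Set.Icc 0 T, -(m * Real.exp ((4 + 4 * B) * t)) ≤ D i j t) :
    ∀ i j, ∀ t ∈ Set.Icc 0 T, -(m / 2 * Real.exp ((4 + 4 * B) * t)) ≤ D i j t := by
  intro i j t ht
  set f : ℝ → ℝ := fun s => Real.exp ((4 + B) * s) * D i j s
    + m / 2 * Real.exp ((8 + 5 * B) * s) with hf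
  have hmono : MonotoneOn f (Set.Icc 0 T) := by
    apply monotoneOn_of_hasDerivWithinAt_nonneg (convex_Icc 0 T)
      (f' := fun s => Real.exp ((4 + B) * s) * (4 + B) * D i j s
        + Real.exp ((4 + B) * s) * D' i j s
        + m / 2 * (Real.exp ((8 + 5 * B) * s) * (8 + 5 * B)))
    · apply ContinuousOn.add
      · exact (by fun_prop : Continuous fun s : ℝ => Real.exp ((4 + B) * s)).continuousOn.mul
          (hcont i j)
      · exact (by fun_prop : Continuous fun s : ℝ =>
          m / 2 * Real.exp ((8 + 5 * B) * s)).continuousOn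
    · intro s hs
      rw [interior_Icc] at hs
      have e1 : HasDerivAt (fun s : ℝ => Real.exp ((4 + B) * s))
          (Real.exp ((4 + B) * s) * (4 + B)) s := by
        simpa using ((hasDerivAt_id s).const_mul (4 + B)).exp
      have e2 : HasDerivAt (fun s : ℝ => Real.exp ((8 + 5 * B) * s))
          (Real.exp ((8 + 5 * B) * s) * (8 + 5 * B)) s := by
        simpa using ((hasDerivAt_id s).const_mul (8 + 5 * B)).exp
      exact ((e1.mul (hder i j s hs)).add (e2.const_mul (m / 2))).hasDerivWithinAt
    · intro s hs
      rw [interior_Icc] at hs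
      have hs' := Set.Ioo_subset_Icc_self hs
      have hE : Real.exp ((8 + 5 * B) * s)
          = Real.exp ((4 + B) * s) * Real.exp ((4 + 4 * B) * s) := by
        rw [← Real.exp_add]; ring_nf
      have h1 := hineq i j s hs
      have n1 := hb (i + 1) j s hs'
      have n2 := hb i (j + 1) s hs'
      have n3 := hb (i - 1) j s hs'
      have n4 := hb i (j - 1) s hs'
      have n5 := hb i j s hs'
      set E := Real.exp ((4 + 4 * B) * s) with hEdef
      have hEpos : 0 < E := Real.exp_pos _
      have h2 : -(2 * (B * (m * E))) ≤ B * D i j s - B * |D i j s| := by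
        rcases le_total 0 (D i j s) with h | h
        · rw [abs_of_nonneg h]
          have : 0 ≤ B * (m * E) := by positivity
          linarith
        · rw [abs_of_nonpos h]
          nlinarith
      have h3 : 0 ≤ (4 + B) * D i j s + D' i j s + m / 2 * (E * (8 + 5 * B)) := by
        unfold lap at h1
        have : 0 ≤ B * (m * E) := by positivity
        nlinarith
      have h4 := mul_nonneg (Real.exp_pos ((4 + B) * s)).le h3
      rw [hE]
      linarith
  have hT : 0 ≤ T := ht.1.trans ht.2
  have h5 := hmono (Set.left_mem_Icc.2 hT) ht ht.1
  have h6 : 0 ≤ f 0 := by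
    simp only [hf, mul_zero, Real.exp_zero, one_mul, mul_one]
    have := h0 i j
    linarith
  have h7 : 0 ≤ Real.exp ((4 + B) * t) * (D i j t + m / 2 * Real.exp ((4 + 4 * B) * t)) := by
    have hE : Real.exp ((8 + 5 * B) * t)
          = Real.exp ((4 + B) * t) * Real.exp ((4 + 4 * B) * t) := by
        rw [← Real.exp_add]; ring_nf
    have := h6.trans h5
    simp only [hf, hE] at this
    linarith
  have h8 := nonneg_of_mul_nonneg_right h7 (Real.exp_pos _)
  linarith

/-- The maximum principle on `ℤ² × [0, T]` for functions that are bounded below. -/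
lemma nonneg_of_lap_le_deriv {D D' : ℤ → ℤ → ℝ → ℝ} {B T M : ℝ} (hB : 0 ≤ B)
    (hcont : ∀ i j, ContinuousOn (D i j) (Set.Icc 0 T))
    (hder : ∀ i j, ∀ t ∈ Set.Ioo 0 T, HasDerivAt (D i j) (D' i j t) t)
    (hineq : ∀ i j, ∀ t ∈ Set.Ioo 0 T, lap D i j t - B * |D i j t| ≤ D' i j t)
    (hbdd : ∀ i j, ∀ t ∈ Set.Icc 0 T, -M ≤ D i j t)
    (h0 : ∀ i j, 0 ≤ D i j 0) :
    ∀ i j, ∀ t ∈ Set.Icc 0 T, 0 ≤ D i j t := by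
  have key : ∀ n : ℕ, ∀ i j, ∀ t ∈ Set.Icc 0 T,
      -(|M| * (1 / 2) ^ n * Real.exp ((4 + 4 * B) * t)) ≤ D i j t := by
    intro n
    induction n with
    | zero =>
      intro i j t ht
      have h1 := hbdd i j t ht
      have h2 : 1 ≤ Real.exp ((4 + 4 * B) * t) := by
        apply Real.one_le_exp
        have := ht.1
        positivity
      have h3 := le_abs_self M
      have h4 := abs_nonneg M
      simp only [pow_zero, mul_one]
      nlinarith
    | succ n ih =>
      have := neg_half_bound_of_neg_bound hB (by positivity) hcont hder hineq h0 ih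
      intro i j t ht
      have h := this i j t ht
      rw [pow_succ]
      calc _ = -(|M| * (1 / 2) ^ n / 2 * Real.exp ((4 + 4 * B) * t)) := by ring
        _ ≤ _ := h
  intro i j t ht
  have hlim : Tendsto (fun n : ℕ => -(|M| * (1 / 2 : ℝ) ^ n * Real.exp ((4 + 4 * B) * t)))
      atTop (𝓝 (-(|M| * 0 * Real.exp ((4 + 4 * B) * t)))) :=
    (((tendsto_pow_atTop_nhds_zero_of_lt_one (by norm_num) (by norm_num)).const_mul _).mul_const
      _).neg
  simp only [mul_zero, zero_mul, neg_zero] at hlim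
  exact le_of_tendsto' hlim fun n => key n i j t ht

/-! ### Compactness of bounded families of solutions -/

lemma exists_lipschitz_bound {g : ℝ → ℝ} (hg : ContDiff ℝ 2 g) (M : ℝ) :
    ∃ B, 0 ≤ B ∧ ∀ x ∈ Set.Icc (-M) M, ∀ y ∈ Set.Icc (-M) M, |g x - g y| ≤ B * |x - y| := by
  have hd : Continuous (deriv g) := hg.continuous_deriv (by norm_num)
  obtain ⟨B, hB⟩ := isCompact_Icc.exists_bound_of_continuousOn (s := Set.Icc (-M) M)
    hd.continuousOn
  refine ⟨|B|, abs_nonneg _, fun x hx y hy => ?_⟩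
  have := (convex_Icc (-M) M).norm_image_sub_le_of_norm_deriv_le (f := g) (C := |B|)
    (fun z _ => (hg.differentiable (by norm_num)) z)
    (fun z hz => (hB z hz).trans (le_abs_self B)) hy hx
  simpa [Real.norm_eq_abs] using this

/-- A Taylor bound with a uniform constant survives pointwise limits, and by
`hasDerivAt_of_abs_taylor_le` it gives back the derivative. So the equation passes to a pointwise
limit without any uniform convergence. -/
lemma abs_taylor_le {f F : ℝ → ℝ} {t L : ℝ}
    (hf : ∀ s, t - 1 ≤ s → s ≤ t + 1 → HasDerivAt f (F s) s)
    (hF : ∀ s, t - 1 ≤ s → s ≤ t + 1 → |F s - F t| ≤ L * |s - t|) {h : ℝ} (hh : |h| ≤ 1)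
    (hL : 0 ≤ L) : |f (t + h) - f t - h * F t| ≤ L * h ^ 2 := by
  have hh' := abs_le.1 hh
  have := (convex_uIcc t (t + h)).norm_image_sub_le_of_norm_hasDerivWithin_le
    (f := fun s => f s - s * F t) (f' := fun s => F s - 1 * F t) (C := L * |h|)
    (fun s hs => by
      have hs1 : t - 1 ≤ s ∧ s ≤ t + 1 := by
        rcases Set.mem_uIcc.1 hs with h | h <;> constructor <;> linarith
      exact ((hf s hs1.1 hs1.2).sub ((hasDerivAt_id s).mul_const (F t))).hasDerivWithinAt)
    (fun s hs => by
      have hs1 : t - 1 ≤ s ∧ s ≤ t + 1 := by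
        rcases Set.mem_uIcc.1 hs with h | h <;> constructor <;> linarith
      have hs2 : |s - t| ≤ |h| := by
        have := Set.abs_sub_left_of_mem_uIcc hs
        simpa using this
      rw [one_mul, Real.norm_eq_abs]
      exact (hF s hs1.1 hs1.2).trans (mul_le_mul_of_nonneg_left hs2 hL))
    Set.left_mem_uIcc Set.right_mem_uIcc
  simp only [Real.norm_eq_abs, add_sub_cancel_left] at this
  calc _ = |f (t + h) - (t + h) * F t - (f t - t * F t)| := by ring_nf
    _ ≤ _ := this
    _ = _ := by rw [mul_assoc, abs_mul_abs_self, sq]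

lemma hasDerivAt_of_abs_taylor_le {f : ℝ → ℝ} {t d L : ℝ}
    (h : ∀ h, |h| ≤ 1 → |f (t + h) - f t - h * d| ≤ L * h ^ 2) : HasDerivAt f d t := by
  rw [hasDerivAt_iff_isLittleO_nhds_zero]
  have h1 : (fun h : ℝ => f (t + h) - f t - h • d) =O[𝓝 0] fun h : ℝ => h ^ 2 := by
    apply Asymptotics.IsBigO.of_bound L
    have : ∀ᶠ x : ℝ in 𝓝 0, |x| ≤ 1 := by
      have := Metric.closedBall_mem_nhds (0 : ℝ) one_pos
      filter_upwards [this] with x hx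
      simpa using hx
    filter_upwards [this] with x hx
    have := h x hx
    simpa [Real.norm_eq_abs] using this
  exact h1.trans_isLittleO (Asymptotics.isLittleO_pow_id one_lt_two)

lemma Ultrafilter.exists_tendsto_of_abs_le {ι : Type*} (U : Ultrafilter ι) {f : ι → ℝ} {M : ℝ}
    (h : ∀ᶠ k in U, |f k| ≤ M) : ∃ x, Tendsto f U (𝓝 x) := by
  have h2 : ∀ᶠ k in U, f k ∈ Set.Icc (-M) M := by
    filter_upwards [h] with k hk using abs_le.1 hk
  obtain ⟨x, -, hx⟩ := isCompact_Icc.ultrafilter_le_nhds' (U.map f) h2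
  exact ⟨x, hx⟩

/-- Limits, along an ultrafilter, of uniformly bounded solutions are solutions. -/
lemma exists_entire_limit {ι : Type*} (U : Ultrafilter ι) {g : ℝ → ℝ} (hg : ContDiff ℝ 2 g)
    {W : ι → ℤ → ℤ → ℝ → ℝ} {M : ℝ}
    (hM : ∀ s : ℝ, ∀ᶠ k in U, ∀ i j t, s ≤ t → |W k i j t| ≤ M)
    (hW : ∀ s : ℝ, ∀ᶠ k in U, ∀ i j t, s ≤ t →
      HasDerivAt (W k i j) (lap (W k) i j t + g (W k i j t)) t) :
    ∃ V : ℤ → ℤ → ℝ → ℝ, IsEntire g V ∧ (∀ i j t, |V i j t| ≤ M) ∧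
      ∀ i j t, Tendsto (fun k => W k i j t) U (𝓝 (V i j t)) := by
  have hex : ∀ i j t, ∃ x, Tendsto (fun k => W k i j t) U (𝓝 x) := fun i j t =>
    U.exists_tendsto_of_abs_le (M := M) (by
      filter_upwards [hM t] with k hk using hk i j t le_rfl)
  choose V hV using hex
  refine ⟨V, fun i j t => ?_, fun i j t => ?_, hV⟩
  swap
  · exact le_of_tendsto (hV i j t).abs (by filter_upwards [hM t] with k hk using hk i j t le_rfl)
  obtain ⟨B, hB, hLip⟩ := exists_lipschitz_bound hg M
  obtain ⟨G, hG⟩ := isCompact_Icc.exists_bound_of_continuousOn (s := Set.Icc (-M) M)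
    hg.continuous.continuousOn
  have hM0 : 0 ≤ M := by
    obtain ⟨k, hk⟩ := (hM t).exists
    exact (abs_nonneg _).trans (hk i j t le_rfl)
  have hG0 : 0 ≤ G := (norm_nonneg _).trans (hG 0 ⟨by linarith, hM0⟩)
  set C := 8 * M + G with hC
  have hC0 : 0 ≤ C := by positivity
  -- `C` bounds the time derivatives of the approximants, so their right-hand sides are Lipschitz in
  -- time: the Laplacian contributes `8 * C`, the reaction `B * C`.
  apply hasDerivAt_of_abs_taylor_le (L := (8 + B) * C)
  intro h hh
  have hlim : Tendsto (fun k => |W k i j (t + h) - W k i j t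
      - h * (lap (W k) i j t + g (W k i j t))|) U
      (𝓝 |V i j (t + h) - V i j t - h * (lap V i j t + g (V i j t))|) := by
    apply Tendsto.abs
    apply ((hV _ _ _).sub (hV _ _ _)).sub
    apply Tendsto.const_mul
    apply Tendsto.add
    · exact ((((hV _ _ _).add (hV _ _ _)).add (hV _ _ _)).add (hV _ _ _)).sub
        ((hV _ _ _).const_mul 4)
    · exact (hg.continuous.tendsto _).comp (hV i j t)
  apply le_of_tendsto hlim
  filter_upwards [hM (t - 1), hW (t - 1)] with k hMk hWk
  have hlapb : ∀ i j s, t - 1 ≤ s → |lap (W k) i j s + g (W k i j s)| ≤ C := by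
    intro i j s hs
    have h1 := abs_le.1 (hMk (i + 1) j s hs)
    have h2 := abs_le.1 (hMk i (j + 1) s hs)
    have h3 := abs_le.1 (hMk (i - 1) j s hs)
    have h4 := abs_le.1 (hMk i (j - 1) s hs)
    have h5 := abs_le.1 (hMk i j s hs)
    have h6 := abs_le.1 (hG _ h5)
    rw [abs_le, lap]
    constructor <;> linarith
  have hLipW : ∀ i j s, t - 1 ≤ s → s ≤ t + 1 → |W k i j s - W k i j t| ≤ C * |s - t| := by
    intro i j s hs hs'
    have := (convex_Icc (t - 1) (t + 1)).norm_image_sub_le_of_norm_hasDerivWithin_le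
      (f := W k i j) (C := C) (fun r hr => (hWk i j r hr.1).hasDerivWithinAt)
      (fun r hr => hlapb i j r hr.1) (x := t) (y := s) ⟨by linarith, by linarith⟩ ⟨hs, hs'⟩
    simpa [Real.norm_eq_abs] using this
  refine abs_taylor_le (F := fun s => lap (W k) i j s + g (W k i j s))
    (fun s hs _ => hWk i j s hs) (fun s hs hs' => ?_) hh (by positivity)
  have h1 := abs_le.1 (hLipW (i + 1) j s hs hs')
  have h2 := abs_le.1 (hLipW i (j + 1) s hs hs')
  have h3 := abs_le.1 (hLipW (i - 1) j s hs hs')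
  have h4 := abs_le.1 (hLipW i (j - 1) s hs hs')
  have h5 := hLipW i j s hs hs'
  have h6 := hLip _ (abs_le.1 (hMk i j s hs)) _ (abs_le.1 (hMk i j t (by linarith)))
  have h7 := abs_le.1 (h6.trans (mul_le_mul_of_nonneg_left h5 hB))
  have h5' := abs_le.1 h5
  simp only [lap]
  rw [abs_le]
  constructor <;> linarith

/-! ### Strong maximum principle and comparison of entire solutions -/

/-- The strong maximum principle: a nonnegative supersolution that vanishes somewhere has
vanished everywhere in the past. -/
lemma eq_zero_of_eq_zero {D D' : ℤ → ℤ → ℝ → ℝ} {B : ℝ} (h0 : ∀ i j t, 0 ≤ D i j t)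
    (hder : ∀ i j t, HasDerivAt (D i j) (D' i j t) t)
    (hineq : ∀ i j t, lap D i j t - B * D i j t ≤ D' i j t)
    {i₀ j₀ : ℤ} {t₀ : ℝ} (hz : D i₀ j₀ t₀ = 0) :
    ∀ i j t, t ≤ t₀ → D i j t = 0 := by
  -- A zero is a minimum in time, so the time derivative vanishes there and the four nonnegative
  -- neighbours have sum at most zero.
  have nbr : ∀ i j, D i j t₀ = 0 → D (i + 1) j t₀ = 0 ∧ D i (j + 1) t₀ = 0 ∧
      D (i - 1) j t₀ = 0 ∧ D i (j - 1) t₀ = 0 := by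
    intro i j hij
    have hmin : IsLocalMin (D i j) t₀ := Eventually.of_forall fun s => by rw [hij]; exact h0 i j s
    have hd := hmin.hasDerivAt_eq_zero (hder i j t₀)
    have h := hineq i j t₀
    rw [hd, lap, hij] at h
    have h1 := h0 (i + 1) j t₀
    have h2 := h0 i (j + 1) t₀
    have h3 := h0 (i - 1) j t₀
    have h4 := h0 i (j - 1) t₀
    refine ⟨?_, ?_, ?_, ?_⟩ <;> linarith
  have row : ∀ i, D i j₀ t₀ = 0 := by
    intro i
    induction i using Int.inductionOn' (b := i₀) with
    | zero => exact hz
    | succ k _ ih => exact (nbr _ _ ih).1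
    | pred k _ ih => exact (nbr _ _ ih).2.2.1
  have all : ∀ i j, D i j t₀ = 0 := by
    intro i j
    induction j using Int.inductionOn' (b := j₀) with
    | zero => exact row i
    | succ k _ ih => exact (nbr _ _ ih).2.1
    | pred k _ ih => exact (nbr _ _ ih).2.2.2
  intro i j t ht
  -- The weighted function is nonnegative, nondecreasing in time and zero at `t₀`, hence zero before
  -- `t₀`.
  have hmono : Monotone fun s => Real.exp ((4 + B) * s) * D i j s := by
    apply monotone_of_hasDerivAt_nonneg
      (f' := fun s => Real.exp ((4 + B) * s) * (4 + B) * D i j s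
        + Real.exp ((4 + B) * s) * D' i j s)
    · intro s
      have e1 : HasDerivAt (fun s : ℝ => Real.exp ((4 + B) * s))
          (Real.exp ((4 + B) * s) * (4 + B)) s := by
        simpa using ((hasDerivAt_id s).const_mul (4 + B)).exp
      exact e1.mul (hder i j s)
    · intro s
      have h := hineq i j s
      rw [lap] at h
      have h1 := h0 (i + 1) j s
      have h2 := h0 i (j + 1) s
      have h3 := h0 (i - 1) j s
      have h4 := h0 i (j - 1) s
      have : 0 ≤ (4 + B) * D i j s + D' i j s := by linarith
      have := mul_nonneg (Real.exp_pos ((4 + B) * s)).le this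
      simp only [Pi.zero_apply]
      linarith
  have h := hmono ht
  simp only [all i j, mul_zero] at h
  have h2 := h0 i j t
  have h3 := Real.exp_pos ((4 + B) * t)
  nlinarith

lemma IsEntire.shift {g : ℝ → ℝ} {W : ℤ → ℤ → ℝ → ℝ} (h : IsEntire g W) (p q : ℤ) (σ : ℝ) :
    IsEntire g fun i j t => W (i + p) (j + q) (t + σ) := by
  intro i j t
  have := (h (i + p) (j + q) (t + σ)).comp_add_const t σ
  simpa only [lap, add_right_comm _ (1 : ℤ), sub_add_eq_add_sub] using this

lemma IsEntire.timeShift {g : ℝ → ℝ} {W : ℤ → ℤ → ℝ → ℝ} (h : IsEntire g W) (σ : ℝ) :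
    IsEntire g fun i j t => W i j (t - σ) :=
  fun i j t => (h i j (t - σ)).comp_sub_const t σ

lemma isEntire_const {g : ℝ → ℝ} {x : ℝ} (hx : g x = 0) : IsEntire g fun _ _ _ => x := by
  intro i j t
  have e : lap (fun _ _ _ => x) i j t + g x = 0 := by
    simp only [lap, hx]
    ring
  change HasDerivAt (fun _ : ℝ => x) (lap (fun _ _ _ => x) i j t + g x) t
  rw [e]
  exact hasDerivAt_const t x

lemma exists_seq_tendsto_lower_bound {f : ℤ → ℤ → ℝ → ℝ} {M : ℝ} (hf : ∀ i j t, M ≤ f i j t) :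
    ∃ m, (∀ i j t, m ≤ f i j t) ∧ ∃ (P Q : ℕ → ℤ) (τ : ℕ → ℝ),
      Tendsto (fun n => f (P n) (Q n) (τ n)) atTop (𝓝 m) := by
  set S : Set ℝ := Set.range fun p : ℤ × ℤ × ℝ => f p.1 p.2.1 p.2.2 with hS
  have hne : S.Nonempty := ⟨_, ⟨(0, 0, 0), rfl⟩⟩
  have hbd : BddBelow S := ⟨M, by rintro _ ⟨p, rfl⟩; exact hf _ _ _⟩
  obtain ⟨v, -, hv, hvS⟩ := exists_seq_tendsto_sInf hne hbd
  choose p hp using hvS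
  refine ⟨sInf S, fun i j t => csInf_le hbd ⟨(i, j, t), rfl⟩, fun n => (p n).1, fun n => (p n).2.1,
    fun n => (p n).2.2, ?_⟩
  simpa only [hp] using hv

/-- Comparison of two bounded entire solutions, assuming that the reaction term damps their
difference wherever they are in the wrong order. -/
lemma IsEntire.le_of_damping {g : ℝ → ℝ} (hg : ContDiff ℝ 2 g) {V W : ℤ → ℤ → ℝ → ℝ}
    (hV : IsEntire g V) (hW : IsEntire g W) {M : ℝ} (hVM : ∀ i j t, |V i j t| ≤ M)
    (hWM : ∀ i j t, |W i j t| ≤ M) {κ : ℝ → ℝ} (hκ : Continuous κ)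
    (hκ0 : ∀ x, 0 < x → x ≤ 2 * M → 0 < κ x)
    (h : ∀ i j t, V i j t < W i j t → κ (W i j t - V i j t) ≤ g (V i j t) - g (W i j t)) :
    ∀ i j t, W i j t ≤ V i j t := by
  by_contra! hcon
  obtain ⟨i₀, j₀, t₀, hlt⟩ := hcon
  have hbd : ∀ i j t, -(2 * M) ≤ V i j t - W i j t := fun i j t => by
    have h1 := abs_le.1 (hVM i j t)
    have h2 := abs_le.1 (hWM i j t)
    linarith
  obtain ⟨m, hm, P, Q, τ, hlim⟩ := exists_seq_tendsto_lower_bound hbd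
  have hm0 : m < 0 := by linarith [hm i₀ j₀ t₀]
  -- The infimum `m` need not be attained. Recentring at a minimising sequence and passing to the
  -- limit gives solutions whose difference attains it at the origin. An ultrafilter avoids diagonal
  -- subsequences.
  set U : Ultrafilter ℕ := hyperfilter ℕ with hU
  have hlimU : Tendsto (fun n => V (P n) (Q n) (τ n) - W (P n) (Q n) (τ n)) U (𝓝 m) :=
    hlim.mono_left Nat.hyperfilter_le_atTop
  obtain ⟨V', hV', hV'M, hVt⟩ := exists_entire_limit U hg
    (W := fun n i j t => V (i + P n) (j + Q n) (t + τ n)) (M := M)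
    (fun s => Eventually.of_forall fun n i j t _ => hVM _ _ _)
    (fun s => Eventually.of_forall fun n i j t _ => hV.shift _ _ _ i j t)
  obtain ⟨W', hW', hW'M, hWt⟩ := exists_entire_limit U hg
    (W := fun n i j t => W (i + P n) (j + Q n) (t + τ n)) (M := M)
    (fun s => Eventually.of_forall fun n i j t _ => hWM _ _ _)
    (fun s => Eventually.of_forall fun n i j t _ => hW.shift _ _ _ i j t)
  have hge : ∀ i j t, m ≤ V' i j t - W' i j t := fun i j t =>
    ge_of_tendsto' ((hVt i j t).sub (hWt i j t)) fun n => hm _ _ _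
  have heq : V' 0 0 0 - W' 0 0 0 = m := by
    refine tendsto_nhds_unique ((hVt 0 0 0).sub (hWt 0 0 0)) ?_
    simpa only [zero_add] using hlimU
  have hmin : IsLocalMin (fun t => V' 0 0 t - W' 0 0 t) 0 :=
    Eventually.of_forall fun s => by simp only [heq]; exact hge 0 0 s
  have hd := hmin.hasDerivAt_eq_zero ((hV' 0 0 0).sub (hW' 0 0 0))
  have hm2 : -m ≤ 2 * M := by linarith [abs_le.1 (hV'M 0 0 0), abs_le.1 (hW'M 0 0 0)]
  have hk : κ (-m) ≤ g (V' 0 0 0) - g (W' 0 0 0) := by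
    have h1 : Tendsto (fun n => κ (W (P n) (Q n) (τ n) - V (P n) (Q n) (τ n))) U (𝓝 (κ (-m))) := by
      refine (hκ.tendsto _).comp ?_
      simpa only [neg_sub] using hlimU.neg
    have h2 : Tendsto (fun n => g (V (P n) (Q n) (τ n)) - g (W (P n) (Q n) (τ n))) U
        (𝓝 (g (V' 0 0 0) - g (W' 0 0 0))) := by
      have := ((hg.continuous.tendsto _).comp (hVt 0 0 0)).sub
        ((hg.continuous.tendsto _).comp (hWt 0 0 0))
      simpa only [zero_add, Function.comp_def] using this
    refine le_of_tendsto_of_tendsto h1 h2 ?_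
    filter_upwards [hlimU.eventually (gt_mem_nhds hm0)] with n hn
    exact h _ _ _ (by linarith)
  -- At the minimum the time derivative of the difference is zero and its Laplacian is nonnegative,
  -- so `g (V' 0 0 0) - g (W' 0 0 0) ≤ 0`, against `hk`.
  have hpos := hκ0 (-m) (by linarith) hm2
  have n1 := hge (0 + 1) 0 0
  have n2 := hge 0 (0 + 1) 0
  have n3 := hge (0 - 1) 0 0
  have n4 := hge 0 (0 - 1) 0
  simp only [lap] at hd
  linarith

/-- Bounded entire solutions take values in `[0, 1]`. -/
lemma IsEntire.mem_Icc {g : ℝ → ℝ} {a : ℝ} (hg : IsBistable g a) {W : ℤ → ℤ → ℝ → ℝ}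
    (hW : IsEntire g W) {M : ℝ} (hWM : ∀ i j t, |W i j t| ≤ M) (i j : ℤ) (t : ℝ) :
    W i j t ∈ Set.Icc 0 1 := by
  have hM : ∀ i j t, |W i j t| ≤ max M 1 := fun i j t => (hWM i j t).trans (le_max_left _ _)
  have hM1 : (1 : ℝ) ≤ max M 1 := le_max_right _ _
  constructor
  · refine IsEntire.le_of_damping hg.contDiff hW (isEntire_const hg.map_zero) hM
      (fun _ _ _ => by simp) (κ := fun x => g (-x)) ?_ ?_ ?_ i j t
    · exact hg.contDiff.continuous.comp continuous_neg
    · intro x hx _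
      exact hg.pos_of_neg _ (by linarith)
    · intro i j t _
      simp [hg.map_zero]
  · refine IsEntire.le_of_damping hg.contDiff (isEntire_const hg.map_one) hW
      (fun _ _ _ => by simp) hM (κ := fun x => -g (1 + x)) ?_ ?_ ?_ i j t
    · exact (hg.contDiff.continuous.comp (continuous_const.add continuous_id)).neg
    · intro x hx _
      have := hg.neg_of_one_lt (1 + x) (by linarith)
      linarith
    · intro i j t _
      simp [hg.map_one]

/-! ### Stable tails and entire fronts -/

/-- `g` is decreasing at rate at least `β` within distance `δ` of `0` and of `1`. -/
def TailDecay (g : ℝ → ℝ) (β δ : ℝ) : Prop :=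
  ∀ x y, x ≤ y → (-δ ≤ x ∧ y ≤ δ) ∨ (1 - δ ≤ x ∧ y ≤ 1 + δ) → β * (y - x) ≤ g x - g y

lemma exists_decay_near {g : ℝ → ℝ} (hg : ContDiff ℝ 2 g) {z : ℝ} (hz : deriv g z < 0) :
    ∃ β δ : ℝ, 0 < β ∧ 0 < δ ∧
      ∀ x y, x ≤ y → z - δ ≤ x → y ≤ z + δ → β * (y - x) ≤ g x - g y := by
  have hd : Continuous (deriv g) := hg.continuous_deriv (by norm_num)
  have hev : ∀ᶠ x in 𝓝 z, deriv g x < deriv g z / 2 :=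
    (hd.tendsto z).eventually (gt_mem_nhds (by linarith))
  obtain ⟨ε, hε, hball⟩ := Metric.eventually_nhds_iff.1 hev
  refine ⟨-(deriv g z / 2), ε / 2, by linarith, by linarith, fun x y hxy hx hy => ?_⟩
  have := (convex_Icc x y).image_sub_le_mul_sub_of_deriv_le (f := g) (C := deriv g z / 2)
    hg.continuous.continuousOn (hg.differentiable (by norm_num)).differentiableOn
    (fun w hw => by
      have hw' := interior_subset hw
      refine (hball ?_).le
      rw [Real.dist_eq, abs_lt]
      constructor <;> linarith [hw'.1, hw'.2])
    x (Set.left_mem_Icc.2 hxy) y (Set.right_mem_Icc.2 hxy) hxy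
  linarith

lemma IsBistable.exists_tailDecay {g : ℝ → ℝ} {a : ℝ} (hg : IsBistable g a) :
    ∃ β δ, 0 < β ∧ 0 < δ ∧ δ ≤ 1 ∧ TailDecay g β δ := by
  obtain ⟨β₀, δ₀, hβ₀, hδ₀, h₀⟩ := exists_decay_near hg.contDiff hg.deriv_zero_neg
  obtain ⟨β₁, δ₁, hβ₁, hδ₁, h₁⟩ := exists_decay_near hg.contDiff hg.deriv_one_neg
  refine ⟨min β₀ β₁, min 1 (min δ₀ δ₁), by positivity, by positivity, min_le_left _ _, ?_⟩
  have e0 : min 1 (min δ₀ δ₁) ≤ δ₀ := (min_le_right _ _).trans (min_le_left _ _)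
  have e1 : min 1 (min δ₀ δ₁) ≤ δ₁ := (min_le_right _ _).trans (min_le_right _ _)
  intro x y hxy h
  rcases h with h | h
  · exact (mul_le_mul_of_nonneg_right (min_le_left _ _) (by linarith)).trans
      (h₀ x y hxy (by linarith) (by linarith))
  · exact (mul_le_mul_of_nonneg_right (min_le_right _ _) (by linarith)).trans
      (h₁ x y hxy (by linarith) (by linarith))

/-- Entire solutions that connect `0` to `1` in the moving coordinate `i - c t`, with modulus of
convergence `ρ`. -/
structure IsFront (g : ℝ → ℝ) (c : ℝ) (ρ : ℝ → ℝ) (W : ℤ → ℤ → ℝ → ℝ) : Prop where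
  entire : IsEntire g W
  mem_Icc : ∀ i j t, W i j t ∈ Set.Icc 0 1
  left : ∀ ε, 0 < ε → ∀ (i j : ℤ) (t : ℝ), i - c * t ≤ -ρ ε → W i j t ≤ ε
  right : ∀ ε, 0 < ε → ∀ (i j : ℤ) (t : ℝ), ρ ε ≤ i - c * t → 1 - ε ≤ W i j t

section
variable {g : ℝ → ℝ} {c : ℝ} {ρ ρ' : ℝ → ℝ} {V W : ℤ → ℤ → ℝ → ℝ}

lemma IsFront.abs_le_one (h : IsFront g c ρ W) (i j : ℤ) (t : ℝ) : |W i j t| ≤ 1 := by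
  have := h.mem_Icc i j t
  rw [abs_of_nonneg this.1]
  exact this.2

lemma IsFront.mono (h : IsFront g c ρ W) (hρ : ∀ ε, ρ ε ≤ ρ' ε) : IsFront g c ρ' W where
  entire := h.entire
  mem_Icc := h.mem_Icc
  left ε hε i j t ht := h.left ε hε i j t (by linarith [hρ ε])
  right ε hε i j t ht := h.right ε hε i j t (by linarith [hρ ε])

lemma IsFront.shift (h : IsFront g c ρ W) {p q : ℤ} {σ N : ℝ} (hN : |p - c * σ| ≤ N) :
    IsFront g c (fun ε => ρ ε + N) fun i j t => W (i + p) (j + q) (t + σ) where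
  entire := h.entire.shift p q σ
  mem_Icc i j t := h.mem_Icc _ _ _
  left ε hε i j t ht := h.left ε hε _ _ _ (by
    have := abs_le.1 hN
    push_cast
    linarith)
  right ε hε i j t ht := h.right ε hε _ _ _ (by
    have := abs_le.1 hN
    push_cast
    linarith)

/-- The common modulus `ρ` is what keeps the tails of the limit attached to `0` and `1`. -/
lemma exists_front_limit {ι : Type*} (U : Ultrafilter ι) (hg : ContDiff ℝ 2 g)
    {W : ι → ℤ → ℤ → ℝ → ℝ} (hW : ∀ k, IsFront g c ρ (W k)) :
    ∃ V, IsFront g c ρ V ∧ ∀ i j t, Tendsto (fun k => W k i j t) U (𝓝 (V i j t)) := by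
  obtain ⟨V, hV, -, ht⟩ := exists_entire_limit U hg (W := W) (M := 1)
    (fun s => Eventually.of_forall fun k i j t _ => (hW k).abs_le_one i j t)
    (fun s => Eventually.of_forall fun k i j t _ => (hW k).entire i j t)
  refine ⟨V, ⟨hV, fun i j t => ⟨?_, ?_⟩, fun ε hε i j t h => ?_, fun ε hε i j t h => ?_⟩, ht⟩
  · exact ge_of_tendsto' (ht i j t) fun k => ((hW k).mem_Icc i j t).1
  · exact le_of_tendsto' (ht i j t) fun k => ((hW k).mem_Icc i j t).2
  · exact le_of_tendsto' (ht i j t) fun k => (hW k).left ε hε i j t h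
  · exact ge_of_tendsto' (ht i j t) fun k => (hW k).right ε hε i j t h

lemma IsFront.exists_lipschitz (hg : ContDiff ℝ 2 g) (h : IsFront g c ρ W) :
    ∃ L, 0 < L ∧ ∀ i j t s, |W i j t - W i j s| ≤ L * |t - s| := by
  obtain ⟨G, hG⟩ := isCompact_Icc.exists_bound_of_continuousOn (s := Set.Icc (0 : ℝ) 1)
    hg.continuous.continuousOn
  have hG0 : 0 ≤ G := (norm_nonneg _).trans (hG 0 ⟨by norm_num, by norm_num⟩)
  refine ⟨8 + G, by positivity, fun i j t s => ?_⟩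
  have := convex_univ.norm_image_sub_le_of_norm_hasDerivWithin_le
    (f := W i j) (C := 8 + G) (fun r _ => (h.entire i j r).hasDerivWithinAt)
    (fun r _ => by
      have h1 := h.mem_Icc (i + 1) j r
      have h2 := h.mem_Icc i (j + 1) r
      have h3 := h.mem_Icc (i - 1) j r
      have h4 := h.mem_Icc i (j - 1) r
      have h5 := h.mem_Icc i j r
      have h6 := abs_le.1 (hG _ h5)
      simp only [Set.mem_Icc] at h1 h2 h3 h4 h5
      rw [Real.norm_eq_abs, abs_le, lap]
      constructor <;> linarith) (Set.mem_univ s) (Set.mem_univ t)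
  simpa [Real.norm_eq_abs] using this

/-- Two entire solutions that are ordered outside the tails are ordered everywhere. -/
lemma IsFront.le_of_tails (hg : ContDiff ℝ 2 g) {β δ : ℝ} (hβ : 0 < β) (hδ : 0 < δ)
    (htail : TailDecay g β δ) (hV : IsEntire g V) (hVI : ∀ i j t, V i j t ∈ Set.Icc 0 1)
    (hW : IsEntire g W) (hWI : ∀ i j t, W i j t ∈ Set.Icc 0 1)
    (h : ∀ i j t, W i j t ≤ δ ∨ 1 - δ ≤ V i j t ∨ W i j t ≤ V i j t) :
    ∀ i j t, W i j t ≤ V i j t := by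
  refine IsEntire.le_of_damping hg hV hW (M := 1) (κ := fun x => β * x) ?_ ?_ (by fun_prop) ?_ ?_
  · exact fun i j t => abs_le.2 ⟨by linarith [(hVI i j t).1], (hVI i j t).2⟩
  · exact fun i j t => abs_le.2 ⟨by linarith [(hWI i j t).1], (hWI i j t).2⟩
  · intro x hx _
    positivity
  · intro i j t hlt
    apply htail _ _ hlt.le
    have h1 := hVI i j t
    have h2 := hWI i j t
    simp only [Set.mem_Icc] at h1 h2
    rcases h i j t with h | h | h
    · left; constructor <;> linarith
    · right; constructor <;> linarith
    · linarith

end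

/-! ### Sliding, and planarity of entire fronts -/

section
variable {g : ℝ → ℝ} {c : ℝ} {ρ ρ' : ℝ → ℝ} {V W : ℤ → ℤ → ℝ → ℝ}

/-- Ordered bounded entire solutions that touch agree in the past. -/
lemma IsEntire.eq_of_touching (hg : ContDiff ℝ 2 g) (hV : IsEntire g V) (hW : IsEntire g W)
    {M : ℝ} (hVM : ∀ i j t, |V i j t| ≤ M) (hWM : ∀ i j t, |W i j t| ≤ M)
    (hle : ∀ i j t, W i j t ≤ V i j t) {i₀ j₀ : ℤ} {t₀ : ℝ} (h : W i₀ j₀ t₀ = V i₀ j₀ t₀) :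
    ∀ i j t, t ≤ t₀ → W i j t = V i j t := by
  obtain ⟨B, hB, hLip⟩ := exists_lipschitz_bound hg M
  intro i j t ht
  have := eq_zero_of_eq_zero (D := fun i j t => V i j t - W i j t) (B := B)
    (fun i j t => sub_nonneg.2 (hle i j t)) (fun i j t => (hV i j t).sub (hW i j t))
    (fun i j t => by
      have h1 := hLip _ (abs_le.1 (hVM i j t)) _ (abs_le.1 (hWM i j t))
      rw [abs_of_nonneg (sub_nonneg.2 (hle i j t))] at h1
      have h2 := (abs_le.1 h1).1
      simp only [lap]
      linarith) (sub_eq_zero.2 h.symm) i j t ht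
  linarith

/-- Sliding: the smallest time shift that puts the front `V` ahead of the front `W`
makes the two touch in the limit along points that stay near the interface. -/
lemma IsFront.exists_touching (hg : ContDiff ℝ 2 g) {β δ : ℝ} (hβ : 0 < β) (hδ : 0 < δ)
    (htail : TailDecay g β δ) (hc : c ≠ 0) (U : Ultrafilter ℕ) (hU : (U : Filter ℕ) ≤ atTop)
    (hV : IsFront g c ρ V) (hW : IsFront g c ρ W) :
    ∃ s N : ℝ, (∀ s', s ≤ s' → ∀ i j t, W i j t ≤ V i j (t - s' / c)) ∧
      ∃ (P Q : ℕ → ℤ) (τ : ℕ → ℝ), (∀ n, |P n - c * τ n| ≤ N) ∧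
      ∃ ρ' V' W', IsFront g c ρ' V' ∧ IsFront g c ρ' W' ∧
        (∀ i j t, Tendsto (fun n => V (i + P n) (j + Q n) (t + τ n)) U (𝓝 (V' i j t))) ∧
        (∀ i j t, Tendsto (fun n => W (i + P n) (j + Q n) (t + τ n)) U (𝓝 (W' i j t))) ∧
        ∀ i j t, t ≤ 0 → W' i j t = V' i j (t - s / c) := by
  have hξ : ∀ (i : ℤ) (t s : ℝ), (i : ℝ) - c * (t - s / c) = i - c * t + s := by
    intro i t s
    field_simp
    ring
  -- Asking for the order at all larger shifts makes `S` upward closed, although `V` is not yet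
  -- known to be monotone in the shift.
  set S : Set ℝ := {s | ∀ s', s ≤ s' → ∀ i j t, W i j t ≤ V i j (t - s' / c)} with hS
  have hcrit : ∀ s : ℝ, (∀ i j t, W i j t ≤ δ ∨ 1 - δ ≤ V i j (t - s / c) ∨
      W i j t ≤ V i j (t - s / c)) → ∀ i j t, W i j t ≤ V i j (t - s / c) := fun s h =>
    IsFront.le_of_tails hg hβ hδ htail (hV.entire.timeShift (s / c)) (fun i j t => hV.mem_Icc _ _ _)
      hW.entire hW.mem_Icc h
  have hne : S.Nonempty := by
    refine ⟨2 * ρ δ, fun s' hs' => hcrit s' fun i j t => ?_⟩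
    rcases le_total ((i : ℝ) - c * t) (-ρ δ) with h | h
    · exact Or.inl (hW.left δ hδ i j t h)
    · exact Or.inr (Or.inl (hV.right δ hδ i j _ (by rw [hξ]; linarith)))
  have hbdd : BddBelow S := by
    -- For a smaller shift, the point with `i - c t = ρ (1/4)` has `W ≥ 3/4` but shifted `V ≤ 1/4`.
    refine ⟨-2 * ρ (1 / 4), fun s hs => ?_⟩
    by_contra! hlt
    have h1 := hs s le_rfl 0 0 (-ρ (1 / 4) / c)
    have h2 := hW.right (1 / 4) (by norm_num) 0 0 (-ρ (1 / 4) / c) (by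
      apply le_of_eq
      field_simp
      simp)
    have h3 := hV.left (1 / 4) (by norm_num) 0 0 (-ρ (1 / 4) / c - s / c) (by
      rw [hξ]
      have : c * (-ρ (1 / 4) / c) = -ρ (1 / 4) := by field_simp
      rw [this]
      push_cast
      linarith)
    linarith
  obtain ⟨L, hL, hLip⟩ := hV.exists_lipschitz hg
  set s := sInf S with hs
  have hgt : ∀ s', s < s' → ∀ i j t, W i j t ≤ V i j (t - s' / c) := by
    intro s' hs'
    obtain ⟨r, hr, hrs⟩ := exists_lt_of_csInf_lt hne hs'
    exact hr s' hrs.le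
  have hmem : ∀ i j t, W i j t ≤ V i j (t - s / c) := by
    intro i j t
    have hcont : Continuous (V i j) :=
      continuous_iff_continuousAt.2 fun t => (hV.entire i j t).continuousAt
    have hlim : Tendsto (fun s' => V i j (t - s' / c)) (𝓝[>] s) (𝓝 (V i j (t - s / c))) :=
      ((by fun_prop : Continuous fun s' => V i j (t - s' / c)).tendsto s).mono_left inf_le_left
    refine ge_of_tendsto hlim ?_
    filter_upwards [self_mem_nhdsWithin] with s' hs'
    exact hgt s' hs' i j t
  -- Outside the strip of half-width `N`, a tail condition holds for every shift in `[s - 1, s]`.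
  set N := |ρ δ| + |s| + 1 with hN
  have htouch : ∀ n : ℕ, ∃ (i j : ℤ) (t : ℝ), |(i : ℝ) - c * t| ≤ N ∧
      V i j (t - s / c) - W i j t < 1 / ((n : ℝ) + 1) := by
    by_contra! hcon
    obtain ⟨n, hn⟩ := hcon
    have hη : (0 : ℝ) < 1 / ((n : ℝ) + 1) := by positivity
    set η := 1 / ((n : ℝ) + 1)
    -- If the gap were at least `η` throughout the strip, lowering the shift by `h` would cost at
    -- most `L * h / |c| ≤ η` there, and the tails take care of themselves. This contradicts the
    -- minimality of `s`.
    set h := min 1 (η * |c| / L) with hh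
    have hc' : 0 < |c| := abs_pos.2 hc
    have hpos : 0 < h := by positivity
    have hmemS : s - h ∈ S := by
      intro s' hs'
      rcases lt_or_ge s s' with hlt | hle
      · exact hgt s' hlt
      refine hcrit s' fun i j t => ?_
      have h1 : h ≤ 1 := min_le_left _ _
      have a1 := le_abs_self (ρ δ)
      have a2 := abs_le.1 (le_refl |s|)
      rcases le_or_gt ((i : ℝ) - c * t) (-N) with hleft | hleft
      · exact Or.inl (hW.left δ hδ i j t (by linarith [abs_nonneg s]))
      rcases le_or_gt N ((i : ℝ) - c * t) with hright | hright
      · exact Or.inr (Or.inl (hV.right δ hδ i j _ (by rw [hξ]; linarith)))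
      · right; right
        have h2 := hn i j t (abs_le.2 ⟨hleft.le, hright.le⟩)
        have h3 := (abs_le.1 (hLip i j (t - s / c) (t - s' / c))).2
        have h4 : |t - s / c - (t - s' / c)| ≤ h / |c| := by
          have : t - s / c - (t - s' / c) = (s' - s) / c := by ring
          rw [this, abs_div]
          gcongr
          rw [abs_le]; constructor <;> linarith
        have h5 : L * (h / |c|) ≤ η := by
          have : h ≤ η * |c| / L := min_le_right _ _
          rw [le_div_iff₀ hL] at this
          rw [mul_div_assoc', div_le_iff₀ hc']
          linarith
        have h6 := mul_le_mul_of_nonneg_left h4 hL.le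
        linarith
    have := csInf_le hbdd hmemS
    linarith
  choose P Q τ hPτ hPQ using htouch
  have hshift : ∀ {X}, IsFront g c ρ X → ∀ n, IsFront g c (fun ε => ρ ε + N)
      fun i j t => X (i + P n) (j + Q n) (t + τ n) := fun hX n => hX.shift (hPτ n)
  obtain ⟨V', hV', hVt⟩ := exists_front_limit U hg (hshift hV)
  obtain ⟨W', hW', hWt⟩ := exists_front_limit U hg (hshift hW)
  refine ⟨s, N, fun s' hs' => ?_, P, Q, τ, hPτ, _, V', W', hV', hW', hVt, hWt, ?_⟩
  · rcases hs'.eq_or_lt with rfl | hlt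
    · exact hmem
    · exact hgt s' hlt
  have hle : ∀ i j t, W' i j t ≤ V' i j (t - s / c) := fun i j t =>
    le_of_tendsto_of_tendsto' (hWt i j t) (hVt i j (t - s / c)) fun n => by
      have := hmem (i + P n) (j + Q n) (t + τ n)
      rwa [sub_add_eq_add_sub]
  refine hV'.entire.timeShift (s / c) |>.eq_of_touching hg hW'.entire (M := 1)
    (fun i j t => hV'.abs_le_one _ _ _) hW'.abs_le_one hle (i₀ := 0) (j₀ := 0)
    (le_antisymm (hle 0 0 0) ?_)
  have hlim := (hVt 0 0 (0 - s / c)).sub (hWt 0 0 0)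
  have hz := le_of_tendsto_of_tendsto' hlim (tendsto_one_div_add_atTop_nhds_zero_nat.mono_left hU)
    fun n => by
      have := hPQ n
      simp only [zero_add, zero_sub] at this ⊢
      rw [neg_add_eq_sub]
      exact this.le
  linarith

lemma IsFront.tendsto_one (hW : IsFront g c ρ W) {x : ℕ → ℤ} {j : ℕ → ℤ} {t : ℕ → ℝ}
    (h : Tendsto (fun n => (x n : ℝ) - c * t n) atTop atTop) :
    Tendsto (fun n => W (x n) (j n) (t n)) atTop (𝓝 1) := by
  rw [Metric.tendsto_atTop']
  intro ε hε
  obtain ⟨N, hN⟩ := eventually_atTop.1 (h.eventually_ge_atTop (ρ (ε / 2)))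
  refine ⟨N, fun n hn => ?_⟩
  have h1 := hW.right (ε / 2) (by linarith) _ (j n) _ (hN n hn.le)
  have h2 := (hW.mem_Icc (x n) (j n) (t n)).2
  rw [Real.dist_eq, abs_lt]
  constructor <;> linarith

lemma IsFront.tendsto_zero (hW : IsFront g c ρ W) {x : ℕ → ℤ} {j : ℕ → ℤ} {t : ℕ → ℝ}
    (h : Tendsto (fun n => (x n : ℝ) - c * t n) atTop atBot) :
    Tendsto (fun n => W (x n) (j n) (t n)) atTop (𝓝 0) := by
  rw [Metric.tendsto_atTop']
  intro ε hε
  obtain ⟨N, hN⟩ := eventually_atTop.1 (h.eventually_le_atBot (-ρ (ε / 2)))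
  refine ⟨N, fun n hn => ?_⟩
  have h1 := hW.left (ε / 2) (by linarith) _ (j n) _ (hN n hn.le)
  have h2 := (hW.mem_Icc (x n) (j n) (t n)).1
  rw [Real.dist_eq, abs_lt]
  constructor <;> linarith

lemma tendsto_const_add_natCast_mul_atTop {r : ℝ} (hr : 0 < r) (x : ℝ) :
    Tendsto (fun n : ℕ => x + n * r) atTop atTop :=
  tendsto_atTop_add_const_left _ _ (tendsto_natCast_atTop_atTop.atTop_mul_const hr)

/-- A front has no space-time period with a nonzero component in the direction of `i - c t`. -/
lemma IsFront.shift_eq_zero_of_periodic (hW : IsFront g c ρ W) {p q : ℤ} {σ : ℝ}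
    (h : ∀ i j t, t ≤ 0 → W i j t = W (i + p) (j + q) (t + σ)) : (p : ℝ) - c * σ = 0 := by
  -- The period is available only for `t ≤ 0`, so its iterates must go backward in time.
  wlog hσ : σ ≤ 0 generalizing W p q σ ρ
  · -- reverse the period, after a translation backward in time
    have hW2 : IsFront g c (fun ε => ρ ε + |(0 : ℤ) - c * (-σ)|)
        fun i j t => W (i + 0) (j + 0) (t + -σ) := hW.shift le_rfl
    have := this hW2 (p := -p) (q := -q) (σ := -σ) (fun i j t ht => ?_) (by linarith)
    · push_cast at this
      linarith
    · have e := h (i + -p) (j + -q) (t + -σ + -σ) (by linarith)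
      simp only [add_zero]
      rw [e, neg_add_cancel_right, neg_add_cancel_right, neg_add_cancel_right]
  have iter : ∀ (n : ℕ) (i : ℤ), W i 0 0 = W (i + n * p) (0 + n * q) (0 + n * σ) := by
    intro n i
    induction n with
    | zero => simp
    | succ n ih =>
      rw [ih, h _ _ _ (by
        have : (n : ℝ) * σ ≤ 0 := mul_nonpos_of_nonneg_of_nonpos (by positivity) hσ
        linarith)]
      have e1 : i + n * p + p = i + (n + 1 : ℕ) * p := by push_cast; ring
      have e2 : 0 + n * q + q = 0 + (n + 1 : ℕ) * q := by push_cast; ring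
      have e3 : 0 + n * σ + σ = 0 + (n + 1 : ℕ) * σ := by push_cast; ring
      rw [e1, e2, e3]
  have hcoord : ∀ (i : ℤ) (n : ℕ), ((i + n * p : ℤ) : ℝ) - c * (0 + n * σ)
      = i + n * (p - c * σ) := by
    intro i n
    push_cast
    ring
  rcases lt_trichotomy ((p : ℝ) - c * σ) 0 with hneg | hz | hpos
  -- Iterating the period moves `i - c t` to `-∞`, so `W` would vanish on the whole row `j = 0` at
  -- time `0`, against its right tail. The positive case is symmetric.
  · exfalso
    have hlim : ∀ i : ℤ, W i 0 0 = 0 := by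
      intro i
      have := hW.tendsto_zero (x := fun n => i + n * p) (j := fun n => 0 + n * q)
        (t := fun n => 0 + n * σ) (by
          simp only [hcoord]
          have := tendsto_neg_atTop_atBot.comp
            (tendsto_const_add_natCast_mul_atTop (neg_pos.2 hneg) (-i))
          refine this.congr fun n => ?_
          simp only [Function.comp]
          ring)
      simp only [← iter] at this
      exact tendsto_nhds_unique tendsto_const_nhds this
    obtain ⟨k, hk⟩ := exists_nat_ge (ρ (1 / 2))
    have := hW.right (1 / 2) (by norm_num) k 0 0 (by push_cast; linarith)
    rw [hlim] at this
    norm_num at this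
  · exact hz
  · exfalso
    have hlim : ∀ i : ℤ, W i 0 0 = 1 := by
      intro i
      have := hW.tendsto_one (x := fun n => i + n * p) (j := fun n => 0 + n * q)
        (t := fun n => 0 + n * σ) (by
          simp only [hcoord]
          exact tendsto_const_add_natCast_mul_atTop hpos i)
      simp only [← iter] at this
      exact tendsto_nhds_unique tendsto_const_nhds this
    obtain ⟨k, hk⟩ := exists_nat_ge (ρ (1 / 2))
    have := hW.left (1 / 2) (by norm_num) (-k) 0 0 (by push_cast; linarith)
    rw [hlim] at this
    norm_num at this

/-- Entire fronts are monotone along shifts that do not decrease `i - c t`. -/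
lemma IsFront.le_shift {a : ℝ} (hg : IsBistable g a) (hc : c ≠ 0) (hW : IsFront g c ρ W)
    (p q : ℤ) {s : ℝ} (hs : 0 ≤ s) (i j : ℤ) (t : ℝ) :
    W i j t ≤ W (i + p) (j + q) (t + p / c - s / c) := by
  obtain ⟨β, δ, hβ, hδ, -, htail⟩ := hg.exists_tailDecay
  -- The comparison front is `W` moved by `(p, q)` in space and `p / c` in time, which preserves `i
  -- - c t`.
  have hN : |(p : ℝ) - c * (p / c)| ≤ 0 := by
    rw [mul_div_cancel₀ _ hc, sub_self, abs_zero]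
  have hV := hW.shift (q := q) hN
  simp only [add_zero] at hV
  obtain ⟨s₀, N, hle, P, Q, τ, hP, ρ', V', W', hV', hW', hVt, hWt, heq⟩ :=
    IsFront.exists_touching hg.contDiff hβ hδ htail hc (hyperfilter ℕ) Nat.hyperfilter_le_atTop
      hV hW
  have hVW : ∀ i j t, V' i j t = W' (i + p) (j + q) (t + p / c) := fun i j t => by
    refine tendsto_nhds_unique (hVt i j t) ?_
    have := hWt (i + p) (j + q) (t + p / c)
    simpa only [add_right_comm] using this
  -- Both limits come from one recentring, so `V'` is a shift of `W'` and their coincidence in the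
  -- past is a period of `W'`. Its component along `i - c t` is `s₀`, which must therefore vanish.
  have hper : (p : ℝ) - c * (p / c - s₀ / c) = 0 :=
    hW'.shift_eq_zero_of_periodic (p := p) (q := q) (σ := p / c - s₀ / c) fun i j t ht => by
      rw [heq i j t ht, hVW]
      congr 1
      ring
  have hs0 : s₀ = 0 := by
    have : (p : ℝ) - c * (p / c - s₀ / c) = s₀ := by field_simp; ring
    linarith
  have := hle s (by linarith) i j t
  rwa [sub_add_eq_add_sub] at this

/-- Entire fronts are planar. -/
lemma IsFront.eq_planar {a : ℝ} (hg : IsBistable g a) (hc : c ≠ 0) (hW : IsFront g c ρ W)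
    (i j : ℤ) (t : ℝ) : W i j t = W 0 0 (t - i / c) := by
  have h1 := hW.le_shift hg hc (-i) (-j) le_rfl i j t
  have h2 := hW.le_shift hg hc i j le_rfl 0 0 (t - i / c)
  simp only [add_neg_cancel, zero_add, zero_div, sub_zero, Int.cast_neg, neg_div,
    ← sub_eq_add_neg, sub_add_cancel] at h1 h2
  exact le_antisymm h1 h2

end

/-! ### The travelling front: monotonicity and uniqueness -/

section
variable {g : ℝ → ℝ} {a c : ℝ} {Φ : ℝ → ℝ} {ρ : ℝ → ℝ} {W : ℤ → ℤ → ℝ → ℝ}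

lemma IsTravellingFront.hasDerivAt (hΦ : IsTravellingFront g c Φ) (ξ : ℝ) :
    HasDerivAt Φ (deriv Φ ξ) ξ :=
  ((hΦ.contDiff.differentiable (by norm_num)) ξ).hasDerivAt

lemma IsTravellingFront.hasDerivAt_planar (hΦ : IsTravellingFront g c Φ) (x t : ℝ) :
    HasDerivAt (fun t => Φ (x - c * t)) (-c * deriv Φ (x - c * t)) t := by
  have h1 : HasDerivAt (fun t : ℝ => x - c * t) (-c) t := by
    simpa using ((hasDerivAt_id t).const_mul c).const_sub x
  have := (hΦ.hasDerivAt (x - c * t)).comp t h1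
  rwa [mul_comm] at this

lemma lap_planar (Ψ : ℝ → ℝ) (x : ℤ → ℝ → ℝ) (hx : ∀ i t, x (i + 1) t = x i t + 1)
    (i j : ℤ) (t : ℝ) :
    lap (fun i _ t => Ψ (x i t)) i j t = Ψ (x i t + 1) + Ψ (x i t - 1) - 2 * Ψ (x i t) := by
  have h : x (i - 1) t = x i t - 1 := by
    have := hx (i - 1) t
    rw [sub_add_cancel] at this
    linarith
  simp only [lap, hx, h]
  ring

lemma IsTravellingFront.isEntire (hΦ : IsTravellingFront g c Φ) :
    IsEntire g fun i _ t => Φ (i - c * t) := by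
  intro i j t
  have := hΦ.hasDerivAt_planar i t
  rw [hΦ.wave_eq] at this
  rwa [lap_planar Φ (fun i t => (i : ℝ) - c * t) (fun i t => by push_cast; ring)]

lemma IsTravellingFront.exists_bound (hΦ : IsTravellingFront g c Φ) : ∃ M, ∀ ξ, |Φ ξ| ≤ M := by
  obtain ⟨A, hA⟩ := eventually_atBot.1
    (hΦ.tendsto_atBot.abs.eventually (gt_mem_nhds (by norm_num : |(0 : ℝ)| < 2)))
  obtain ⟨B, hB⟩ := eventually_atTop.1
    (hΦ.tendsto_atTop.abs.eventually (gt_mem_nhds (by norm_num : |(1 : ℝ)| < 2)))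
  obtain ⟨M, hM⟩ := isCompact_Icc.exists_bound_of_continuousOn (s := Set.Icc A B)
    hΦ.contDiff.continuous.continuousOn
  refine ⟨max 2 M, fun ξ => ?_⟩
  rcases le_total ξ A with h | h
  · exact (hA ξ h).le.trans (le_max_left _ _)
  rcases le_total B ξ with h' | h'
  · exact (hB ξ h').le.trans (le_max_left _ _)
  · exact (hM ξ ⟨h, h'⟩).trans (le_max_right _ _)

lemma IsTravellingFront.mem_Icc (hg : IsBistable g a) (hΦ : IsTravellingFront g c Φ) (ξ : ℝ) :
    Φ ξ ∈ Set.Icc 0 1 := by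
  obtain ⟨M, hM⟩ := hΦ.exists_bound
  have := hΦ.isEntire.mem_Icc hg (M := M) (fun i j t => hM _) 0 0 (-ξ / c)
  have e : ((0 : ℤ) : ℝ) - c * (-ξ / c) = ξ := by
    have := hΦ.speed_ne_zero
    push_cast
    field_simp
    ring
  simpa only [e] using this

lemma IsTravellingFront.exists_isFront (hg : IsBistable g a) (hΦ : IsTravellingFront g c Φ) :
    ∃ ρ, IsFront g c ρ fun i _ t => Φ (i - c * t) := by
  have h : ∀ ε : ℝ, ∃ R : ℝ, 0 < ε → (∀ ξ, ξ ≤ -R → Φ ξ ≤ ε) ∧ ∀ ξ, R ≤ ξ → 1 - ε ≤ Φ ξ := by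
    intro ε
    by_cases hε : 0 < ε
    · obtain ⟨A, hA⟩ := eventually_atBot.1 (hΦ.tendsto_atBot.eventually (gt_mem_nhds hε))
      obtain ⟨B, hB⟩ := eventually_atTop.1
        (hΦ.tendsto_atTop.eventually (lt_mem_nhds (by linarith : 1 - ε < 1)))
      refine ⟨max (-A) B, fun _ => ⟨fun ξ hξ => (hA ξ ?_).le, fun ξ hξ => (hB ξ ?_).le⟩⟩
      · linarith [le_max_left (-A) B]
      · exact (le_max_right _ _).trans hξ
    · exact ⟨0, fun h => absurd h hε⟩
  choose ρ hρ using h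
  exact ⟨ρ, hΦ.isEntire, fun i j t => hΦ.mem_Icc hg _, fun ε hε i j t h => (hρ ε hε).1 _ h,
    fun ε hε i j t h => (hρ ε hε).2 _ h⟩

/-- The strong maximum principle gives information only about the past. As `c ≠ 0`, the past already
meets every value of `i - c t`, so this information reaches the whole profile. -/
lemma IsTravellingFront.exists_time (hΦ : IsTravellingFront g c Φ) (ξ t₀ : ℝ) :
    ∃ (i : ℤ) (t : ℝ), t ≤ t₀ ∧ (i : ℝ) - c * t = ξ := by
  have hc := hΦ.speed_ne_zero
  rcases hc.lt_or_gt with h | h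
  · obtain ⟨n, hn⟩ := exists_int_ge (ξ + c * t₀)
    refine ⟨n, (n - ξ) / c, ?_, by field_simp; ring⟩
    rw [div_le_iff_of_neg h]
    linarith
  · obtain ⟨n, hn⟩ := exists_int_le (ξ + c * t₀)
    refine ⟨n, (n - ξ) / c, ?_, by field_simp; ring⟩
    rw [div_le_iff₀ h]
    linarith

lemma IsTravellingFront.coord (hΦ : IsTravellingFront g c Φ) (x t s : ℝ) :
    x - c * (t - s / c) = x - c * t + s := by
  have := hΦ.speed_ne_zero
  field_simp
  ring

lemma IsTravellingFront.monotone (hg : IsBistable g a) (hΦ : IsTravellingFront g c Φ) :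
    Monotone Φ := by
  intro x y hxy
  obtain ⟨ρ, hF⟩ := hΦ.exists_isFront hg
  obtain ⟨i, t, -, hit⟩ := hΦ.exists_time x 0
  have := hF.le_shift hg hΦ.speed_ne_zero 0 0 (sub_nonneg.2 hxy) i 0 t
  simp only [add_zero, Int.cast_zero, zero_div, hΦ.coord, hit] at this
  rwa [add_sub_cancel] at this

/-- Equality at two points makes `Φ` touch a translate of itself, hence be periodic, which is
incompatible with `Φ 0 = 1/2` and the limit `1`. -/
lemma IsTravellingFront.strictMono (hg : IsBistable g a) (hΦ : IsTravellingFront g c Φ) :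
    StrictMono Φ := by
  intro x y hxy
  refine lt_of_le_of_ne (hΦ.monotone hg hxy.le) fun heq => ?_
  obtain ⟨i, t, -, hit⟩ := hΦ.exists_time x 0
  obtain ⟨M, hM⟩ := hΦ.exists_bound
  have h1 := (hΦ.isEntire.timeShift ((y - x) / c)).eq_of_touching hg.contDiff hΦ.isEntire
    (fun _ _ _ => hM _) (fun _ _ _ => hM _) (fun i _ t => hΦ.monotone hg (by
      rw [hΦ.coord]
      linarith)) (i₀ := i) (j₀ := 0) (t₀ := t) (by rw [hΦ.coord, hit, heq]; congr 1; ring)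
  have hper : ∀ ξ, Φ ξ = Φ (ξ + (y - x)) := by
    intro ξ
    obtain ⟨k, s, hs, hks⟩ := hΦ.exists_time ξ t
    have := h1 k 0 s hs
    rwa [hΦ.coord, hks] at this
  have hn : ∀ n : ℕ, Φ (0 + n * (y - x)) = Φ 0 := by
    intro n
    induction n with
    | zero => simp
    | succ n ih =>
      rw [← ih, hper (0 + n * (y - x))]
      push_cast
      congr 1
      ring
  have hlim := hΦ.tendsto_atTop.comp (tendsto_const_add_natCast_mul_atTop (sub_pos.2 hxy) 0)
  simp only [Function.comp_def, hn, hΦ.map_zero] at hlim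
  have := tendsto_nhds_unique tendsto_const_nhds hlim
  norm_num at this

lemma IsTravellingFront.deriv_eq (hΦ : IsTravellingFront g c Φ) :
    deriv Φ = fun ξ => -(Φ (ξ + 1) + Φ (ξ - 1) - 2 * Φ ξ + g (Φ ξ)) / c := by
  ext ξ
  have := hΦ.speed_ne_zero
  rw [eq_div_iff this, ← hΦ.wave_eq]
  ring

/-- The derivative is a nonnegative solution of the linearised equation, so by the strong maximum
principle one zero would make `Φ` constant. Positivity on compact sets is what the Fife-McLeod
barrier needs. -/
lemma IsTravellingFront.deriv_pos (hg : IsBistable g a) (hΦ : IsTravellingFront g c Φ) (ξ : ℝ) :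
    0 < deriv Φ ξ := by
  have hnn : ∀ ξ, 0 ≤ deriv Φ ξ := fun ξ => (hΦ.monotone hg).deriv_nonneg
  refine lt_of_le_of_ne (hnn ξ) fun hz => ?_
  have hdg : ∀ x, HasDerivAt g (deriv g x) x := fun x =>
    (hg.contDiff.differentiable (by norm_num) x).hasDerivAt
  obtain ⟨B, hB⟩ := isCompact_Icc.exists_bound_of_continuousOn (s := Set.Icc (0 : ℝ) 1)
    (hg.contDiff.continuous_deriv (by norm_num)).continuousOn
  have hder : ∀ ξ, HasDerivAt (deriv Φ) (-(deriv Φ (ξ + 1) + deriv Φ (ξ - 1) - 2 * deriv Φ ξ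
      + deriv g (Φ ξ) * deriv Φ ξ) / c) ξ := by
    intro ξ
    have e : ∀ ξ, HasDerivAt (fun ξ => -(Φ (ξ + 1) + Φ (ξ - 1) - 2 * Φ ξ + g (Φ ξ)) / c)
        (-(deriv Φ (ξ + 1) + deriv Φ (ξ - 1) - 2 * deriv Φ ξ
        + deriv g (Φ ξ) * deriv Φ ξ) / c) ξ := fun ξ =>
      (((((hΦ.hasDerivAt (ξ + 1)).comp_add_const ξ 1).add
        ((hΦ.hasDerivAt (ξ - 1)).comp_sub_const ξ 1)).sub ((hΦ.hasDerivAt ξ).const_mul 2)).add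
        ((hdg (Φ ξ)).comp ξ (hΦ.hasDerivAt ξ))).neg.div_const c
    have := e ξ
    rwa [← hΦ.deriv_eq] at this
  obtain ⟨i, t, -, hit⟩ := hΦ.exists_time ξ 0
  have hzero := eq_zero_of_eq_zero (D := fun i _ t => deriv Φ (i - c * t)) (B := B)
    (D' := fun i _ t => (-(deriv Φ (i - c * t + 1) + deriv Φ (i - c * t - 1)
      - 2 * deriv Φ (i - c * t) + deriv g (Φ (i - c * t)) * deriv Φ (i - c * t)) / c) * (-c))
    (fun i _ t => hnn _)
    (fun i j t => by
      have h1 : HasDerivAt (fun t : ℝ => i - c * t) (-c) t := by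
        simpa using ((hasDerivAt_id t).const_mul c).const_sub (i : ℝ)
      exact (hder _).comp t h1)
    (fun i j t => by
      rw [lap_planar (deriv Φ) (fun i t => (i : ℝ) - c * t) (fun i t => by push_cast; ring)]
      have h1 := (abs_le.1 (hB _ (hΦ.mem_Icc hg (i - c * t)))).1
      have h2 := mul_le_mul_of_nonneg_right h1 (hnn (i - c * t))
      have h3 : ∀ x : ℝ, -x / c * -c = x := fun x => by
        have := hΦ.speed_ne_zero
        field_simp
      rw [h3]
      linarith) (i₀ := i) (j₀ := 0) (t₀ := t) (by simp only [hit]; exact hz.symm)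
  have hall : ∀ ξ, deriv Φ ξ = 0 := by
    intro ξ
    obtain ⟨k, s, hs, hks⟩ := hΦ.exists_time ξ t
    simpa only [hks] using hzero k 0 s hs
  have := is_const_of_deriv_eq_zero (hΦ.contDiff.differentiable (by norm_num)) hall 0 1
  exact (hΦ.strictMono hg (zero_lt_one' ℝ)).ne this

lemma IsTravellingFront.pos (hg : IsBistable g a) (hΦ : IsTravellingFront g c Φ) (ξ : ℝ) :
    0 < Φ ξ :=
  (hΦ.mem_Icc hg (ξ - 1)).1.trans_lt (hΦ.strictMono hg (by linarith))

lemma IsTravellingFront.lt_one (hg : IsBistable g a) (hΦ : IsTravellingFront g c Φ) (ξ : ℝ) :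
    Φ ξ < 1 :=
  (hΦ.strictMono hg (by linarith : ξ < ξ + 1)).trans_le (hΦ.mem_Icc hg (ξ + 1)).2

/-- Every entire front is a translate of the travelling front. -/
lemma IsFront.exists_eq_translate (hg : IsBistable g a) (hΦ : IsTravellingFront g c Φ)
    (hW : IsFront g c ρ W) : ∃ θ, ∀ i j t, W i j t = Φ (i - c * t + θ) := by
  have hc := hΦ.speed_ne_zero
  obtain ⟨β, δ, hβ, hδ, -, htail⟩ := hg.exists_tailDecay
  obtain ⟨ρ₀, hF⟩ := hΦ.exists_isFront hg
  obtain ⟨s, N, -, P, Q, τ, hP, ρ', V', W', hV', hW', hVt, hWt, heq⟩ :=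
    IsFront.exists_touching hg.contDiff hβ hδ htail hc (hyperfilter ℕ) Nat.hyperfilter_le_atTop
      (hF.mono fun ε => le_max_left (ρ₀ ε) (ρ ε)) (hW.mono fun ε => le_max_right (ρ₀ ε) (ρ ε))
  -- Both fronts are planar, so recentring changes each only through `P n - c * τ n`. Its limit `x`
  -- enters both in the same way and cancels, and coincidence of the limits gives coincidence of the
  -- originals.
  obtain ⟨x, hx⟩ := (hyperfilter ℕ).exists_tendsto_of_abs_le (Eventually.of_forall hP)
  have hV0 : ∀ i j t, V' i j t = Φ (i - c * t + x) := by
    intro i j t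
    refine tendsto_nhds_unique (hVt i j t) ?_
    have := (hΦ.contDiff.continuous.tendsto _).comp (hx.const_add ((i : ℝ) - c * t))
    refine this.congr fun n => ?_
    simp only [Function.comp]
    push_cast
    congr 1
    ring
  have hcW : Continuous (W 0 0) :=
    continuous_iff_continuousAt.2 fun t => (hW.entire 0 0 t).continuousAt
  have hW0 : ∀ i j t, W' i j t = W 0 0 (-(i - c * t + x) / c) := by
    intro i j t
    refine tendsto_nhds_unique (hWt i j t) ?_
    have := (hcW.tendsto _).comp ((hx.const_add ((i : ℝ) - c * t)).neg.div_const c)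
    refine this.congr fun n => ?_
    rw [hW.eq_planar hg hc]
    simp only [Function.comp]
    push_cast
    congr 1
    field_simp
    ring
  refine ⟨s, fun i j t => ?_⟩
  obtain ⟨k, r, hr, hkr⟩ := hΦ.exists_time (i - c * t - x) 0
  have h := heq k 0 r hr
  rw [hW0, hV0, hΦ.coord, hkr] at h
  rw [hW.eq_planar hg hc]
  convert h using 2
  · field_simp
    ring
  · ring

end

/-! ### Barriers for the initial value problem -/

/-- Solutions of the lattice initial value problem that are bounded on bounded time intervals. -/
structure IsForward (g : ℝ → ℝ) (W : ℤ → ℤ → ℝ → ℝ) : Prop where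
  continuousOn : ∀ i j, ContinuousOn (W i j) (Set.Ici 0)
  hasDerivAt : ∀ i j t, 0 < t → HasDerivAt (W i j) (lap W i j t + g (W i j t)) t
  bounded : ∀ T, ∃ M, ∀ i j, ∀ t ∈ Set.Icc 0 T, |W i j t| ≤ M

section
variable {g : ℝ → ℝ} {a c : ℝ} {Φ : ℝ → ℝ} {W : ℤ → ℤ → ℝ → ℝ}

lemma IsForward.timeShift (hW : IsForward g W) {s : ℝ} (hs : 0 ≤ s) :
    IsForward g fun i j t => W i j (t + s) where
  continuousOn i j := (hW.continuousOn i j).comp (by fun_prop) fun t ht => by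
    simp only [Set.mem_Ici] at ht ⊢
    linarith
  hasDerivAt i j t ht := (hW.hasDerivAt i j (t + s) (by linarith)).comp_add_const t s
  bounded T := by
    obtain ⟨M, hM⟩ := hW.bounded (T + s)
    exact ⟨M, fun i j t ht => hM i j _ ⟨by linarith [ht.1], by linarith [ht.2]⟩⟩

lemma IsForward.le_of_supersolution (hg : ContDiff ℝ 2 g) (hW : IsForward g W)
    {V V' : ℤ → ℤ → ℝ → ℝ} {T M : ℝ} (hVc : ∀ i j, ContinuousOn (V i j) (Set.Icc 0 T))
    (hVd : ∀ i j, ∀ t ∈ Set.Ioo 0 T, HasDerivAt (V i j) (V' i j t) t)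
    (hV : ∀ i j, ∀ t ∈ Set.Ioo 0 T, lap V i j t + g (V i j t) ≤ V' i j t)
    (hVM : ∀ i j, ∀ t ∈ Set.Icc 0 T, |V i j t| ≤ M) (h0 : ∀ i j, W i j 0 ≤ V i j 0) :
    ∀ i j, ∀ t ∈ Set.Icc 0 T, W i j t ≤ V i j t := by
  obtain ⟨M', hM'⟩ := hW.bounded T
  obtain ⟨B, hB, hLip⟩ := exists_lipschitz_bound hg (max M M')
  have hVI : ∀ i j, ∀ t ∈ Set.Icc 0 T, V i j t ∈ Set.Icc (-(max M M')) (max M M') :=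
    fun i j t ht => abs_le.1 ((hVM i j t ht).trans (le_max_left _ _))
  have hWI : ∀ i j, ∀ t ∈ Set.Icc 0 T, W i j t ∈ Set.Icc (-(max M M')) (max M M') :=
    fun i j t ht => abs_le.1 ((hM' i j t ht).trans (le_max_right _ _))
  intro i j t ht
  have := nonneg_of_lap_le_deriv (D := fun i j t => V i j t - W i j t) hB
    (fun i j => (hVc i j).sub ((hW.continuousOn i j).mono Set.Icc_subset_Ici_self))
    (fun i j t ht => (hVd i j t ht).sub (hW.hasDerivAt i j t ht.1))
    (fun i j t ht => by
      have ht' := Set.Ioo_subset_Icc_self ht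
      have h1 := hV i j t ht
      have h2 := (abs_le.1 (hLip _ (hVI i j t ht') _ (hWI i j t ht'))).1
      simp only [lap] at h1 ⊢
      linarith)
    (M := 2 * max M M')
    (fun i j t ht => by linarith [(hVI i j t ht).1, (hWI i j t ht).2])
    (fun i j => sub_nonneg.2 (h0 i j)) i j t ht
  exact sub_nonneg.1 this

lemma IsForward.exists_upper_bound (hg : IsBistable g a) (hW : IsForward g W) :
    ∃ K, 1 ≤ K ∧ ∀ i j t, 0 ≤ t → W i j t ≤ K := by
  obtain ⟨M, hM⟩ := hW.bounded 0
  refine ⟨max 1 M, le_max_left _ _, fun i j t ht => ?_⟩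
  have hgK : g (max 1 M) ≤ 0 := by
    rcases (le_max_left 1 M).eq_or_lt with h | h
    · rw [← h, hg.map_one]
    · exact (hg.neg_of_one_lt _ h).le
  exact hW.le_of_supersolution hg.contDiff (V := fun _ _ _ => max 1 M) (V' := fun _ _ _ => 0)
    (T := t) (fun _ _ => continuousOn_const) (fun _ _ t _ => hasDerivAt_const t _)
    (fun _ _ _ _ => by simp only [lap]; linarith) (fun _ _ _ _ => le_rfl)
    (fun i j => (le_abs_self _).trans ((hM i j 0 (by simp)).trans (le_max_right _ _)))
    i j t ⟨ht, le_rfl⟩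

/-- Affine functions with small negative slope are supersolutions of `y' = g y` as long as they
stay where `g` is negative. -/
lemma exists_affine_descent (hg : Continuous g) {p r : ℝ} (hpr : p ≤ r)
    (hneg : ∀ x ∈ Set.Icc p r, g x < 0) :
    ∃ T₀, 0 < T₀ ∧ ∀ T, T₀ ≤ T → ∀ t ∈ Set.Icc 0 T,
      r - (r - p) / T * t ∈ Set.Icc p r ∧ g (r - (r - p) / T * t) ≤ -((r - p) / T) := by
  obtain ⟨x₀, hx₀, hmax⟩ := isCompact_Icc.exists_isMaxOn (Set.nonempty_Icc.2 hpr) hg.continuousOn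
  have hκ := hneg x₀ hx₀
  refine ⟨(r - p) / (-g x₀) + 1, ?_, fun T hT t ht => ?_⟩
  · have : 0 ≤ (r - p) / (-g x₀) := div_nonneg (by linarith) (by linarith)
    linarith
  have h1 : 0 ≤ (r - p) / (-g x₀) := div_nonneg (by linarith) (by linarith)
  have hT0 : 0 < T := by linarith
  have h2 : 0 ≤ (r - p) / T := div_nonneg (by linarith) hT0.le
  have h3 : (r - p) / T * t ≤ r - p := by
    calc (r - p) / T * t ≤ (r - p) / T * T := mul_le_mul_of_nonneg_left ht.2 h2
      _ = r - p := by field_simp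
  have hmem : r - (r - p) / T * t ∈ Set.Icc p r :=
    ⟨by linarith, by linarith [mul_nonneg h2 ht.1]⟩
  refine ⟨hmem, (hmax hmem).trans ?_⟩
  have : (r - p) / T ≤ -g x₀ := by
    rw [div_le_iff₀ hT0]
    have h4 : (r - p) / (-g x₀) ≤ T := by linarith
    rw [div_le_iff₀ (by linarith)] at h4
    linarith
  linarith

lemma IsForward.exists_time_le_one_add (hg : IsBistable g a) (hW : IsForward g W) {q : ℝ}
    (hq : 0 < q) : ∃ T₀, 0 < T₀ ∧ ∀ T, T₀ ≤ T → ∀ i j, W i j T ≤ 1 + q := by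
  obtain ⟨K, hK1, hK⟩ := hW.exists_upper_bound hg
  obtain ⟨T₀, hT₀, h⟩ := exists_affine_descent (p := 1 + q) (r := max K (1 + q))
    hg.contDiff.continuous (le_max_right _ _)
    (fun x hx => hg.neg_of_one_lt x (by linarith [hx.1]))
  refine ⟨T₀, hT₀, fun T hT i j => ?_⟩
  have hT0 : 0 < T := hT₀.trans_le hT
  have := hW.le_of_supersolution hg.contDiff
    (V := fun _ _ t => max K (1 + q) - (max K (1 + q) - (1 + q)) / T * t)
    (V' := fun _ _ _ => -((max K (1 + q) - (1 + q)) / T)) (T := T) (M := max K (1 + q))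
    (fun _ _ => by fun_prop)
    (fun _ _ t _ => by
      simpa using ((hasDerivAt_id t).const_mul ((max K (1 + q) - (1 + q)) / T)).const_sub
        (max K (1 + q)))
    (fun _ _ t ht => by
      have := (h T hT t (Set.Ioo_subset_Icc_self ht)).2
      simp only [lap]
      linarith)
    (fun _ _ t ht => by
      have := (h T hT t ht).1
      exact abs_le.2 ⟨by linarith [this.1, le_max_left K (1 + q)], this.2⟩)
    (fun i j => by
      have := (hK i j 0 le_rfl).trans (le_max_left K (1 + q))
      simpa using this) i j T ⟨hT0.le, le_rfl⟩
  rw [div_mul_cancel₀ _ hT0.ne'] at this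
  linarith

/-- Below the unstable state on the far left, a solution approaches zero there. -/
lemma IsForward.exists_time_le_left (hg : IsBistable g a) (hW : IsForward g W) {y₀ : ℝ}
    (hy₀ : y₀ < a) {N : ℝ} (hN : ∀ i j : ℤ, (i : ℝ) ≤ N → W i j 0 ≤ y₀) {q : ℝ} (hq : 0 < q) :
    ∃ T₀, 0 < T₀ ∧ ∀ T, T₀ ≤ T → ∃ N' : ℝ, ∀ i j : ℤ, (i : ℝ) ≤ N' → W i j T ≤ q := by
  have ha := hg.a_pos
  -- The affine part descends from `r` to `p` inside `(0, a)`; `p ≤ q / 2` leaves `q / 2` for the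
  -- exponential part.
  set r := max y₀ (a / 2) with hr
  have hra : r < a := max_lt hy₀ (by linarith)
  have hr0 : 0 < r := (by linarith : 0 < a / 2).trans_le (le_max_right _ _)
  set p := min (q / 2) r with hp
  have hp0 : 0 < p := lt_min (by linarith) hr0
  obtain ⟨T₀, hT₀, h⟩ := exists_affine_descent (p := p) (r := r)
    hg.contDiff.continuous (min_le_right _ _)
    (fun x hx => hg.neg_of_lt_a x (by linarith [hx.1]) (by linarith [hx.2]))
  refine ⟨T₀, hT₀, fun T hT => ?_⟩
  have hT0 : 0 < T := hT₀.trans_le hT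
  obtain ⟨M, hM⟩ := hW.bounded T
  set K := max M 1 with hK
  have hK1 : (1 : ℝ) ≤ K := le_max_right _ _
  obtain ⟨B, hB, hLip⟩ := exists_lipschitz_bound hg.contDiff K
  have hWK : ∀ i j, ∀ t ∈ Set.Icc 0 T, W i j t ∈ Set.Icc (-K) K := fun i j t ht =>
    abs_le.1 ((hM i j t ht).trans (le_max_left _ _))
  have hyK : ∀ t ∈ Set.Icc 0 T, r - (r - p) / T * t ∈ Set.Icc (-K) K := fun t ht => by
    have := (h T hT t ht).1
    have := hg.a_lt_one
    constructor <;> linarith [(h T hT t ht).1.1, (h T hT t ht).1.2]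
  -- The exponential `exp i` is an eigenfunction of the Laplacian with eigenvalue `ν`. Growth at
  -- rate `ν + B` absorbs the Lipschitz error of `g`, and `A` makes the barrier exceed the solution
  -- initially to the right of `N`. At the fixed time `T` it is still negligible on the far left.
  set ν := Real.exp 1 + Real.exp (-1) - 2 with hν
  set L := ν + B with hL
  set A := 2 * K * Real.exp (-N) with hA
  have hA0 : 0 < A := by positivity
  set E : ℤ → ℤ → ℝ → ℝ := fun i _ t => A * Real.exp (i + L * t) with hE
  have hE0 : ∀ i j t, 0 < E i j t := fun i j t => by positivity
  have hlapE : ∀ i j t, lap E i j t = ν * E i j t := by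
    intro i j t
    have e1 : Real.exp (((i + 1 : ℤ) : ℝ) + L * t) = Real.exp (i + L * t) * Real.exp 1 := by
      rw [← Real.exp_add]
      push_cast
      ring_nf
    have e2 : Real.exp (((i - 1 : ℤ) : ℝ) + L * t) = Real.exp (i + L * t) * Real.exp (-1) := by
      rw [← Real.exp_add]
      push_cast
      ring_nf
    simp only [lap, hE, e1, e2, hν]
    ring
  have key := nonneg_of_lap_le_deriv (T := T) (M := K + K) (B := B)
    (D := fun i j t => (r - (r - p) / T * t) + E i j t - W i j t)
    (D' := fun i j t => -((r - p) / T) + L * E i j t - (lap W i j t + g (W i j t))) hB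
    (fun i j => by
      refine ContinuousOn.sub ?_ ((hW.continuousOn i j).mono Set.Icc_subset_Ici_self)
      simp only [hE]
      fun_prop)
    (fun i j t ht => by
      refine HasDerivAt.sub (HasDerivAt.add ?_ ?_) (hW.hasDerivAt i j t ht.1)
      · simpa using ((hasDerivAt_id t).const_mul ((r - p) / T)).const_sub r
      · have := ((((hasDerivAt_id t).const_mul L).const_add (i : ℝ)).exp).const_mul A
        exact this.congr_deriv (by simp only [hE, id]; ring))
    (fun i j t ht => by
      have ht' := Set.Ioo_subset_Icc_self ht
      set y := r - (r - p) / T * t with hy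
      have h1 := (h T hT t ht').2
      have h2 := (abs_le.1 (hLip _ (hWK i j t ht') _ (hyK t ht'))).2
      have h3 : |W i j t - y| ≤ |y + E i j t - W i j t| + E i j t := by
        have := abs_sub_abs_le_abs_sub (W i j t - y) (E i j t)
        rw [abs_of_pos (hE0 i j t), ← abs_neg (W i j t - y - E i j t)] at this
        have e : -(W i j t - y - E i j t) = y + E i j t - W i j t := by ring
        rw [e] at this
        linarith
      have h4 := mul_le_mul_of_nonneg_left h3 hB
      have h5 : lap (fun i j t => (r - (r - p) / T * t) + E i j t - W i j t) i j t
          = lap E i j t - lap W i j t := by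
        simp only [lap]
        ring
      rw [h5, hlapE, hL]
      linarith)
    (fun i j t ht => by
      linarith [(hyK t ht).1, (hWK i j t ht).2, hE0 i j t])
    (fun i j => by
      have h0 : (0 : ℝ) ∈ Set.Icc 0 T := ⟨le_rfl, hT0.le⟩
      have h1 := hE0 i j 0
      rcases le_total (i : ℝ) N with hi | hi
      · have h2 := (hN i j hi).trans (le_max_left y₀ (a / 2))
        simp only [mul_zero, sub_zero]
        linarith
      · have h2 : 1 ≤ Real.exp (-N) * Real.exp (i + L * 0) := by
          rw [← Real.exp_add]
          apply Real.one_le_exp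
          linarith
        have h3 : 2 * K ≤ E i j 0 := by
          simp only [hE, hA]
          nlinarith
        linarith [(hyK 0 h0).1, (hWK i j 0 h0).2])
  have hlim : Tendsto (fun x : ℝ => A * Real.exp (x + L * T)) atBot (𝓝 (A * 0)) :=
    (Real.tendsto_exp_atBot.comp (tendsto_atBot_add_const_right _ _ tendsto_id)).const_mul A
  rw [mul_zero] at hlim
  obtain ⟨N', hN'⟩ := eventually_atBot.1 (hlim.eventually (gt_mem_nhds (half_pos hq)))
  refine ⟨N', fun i j hi => ?_⟩
  have h1 := key i j T ⟨hT0.le, le_rfl⟩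
  have h2 := hN' i hi
  simp only [hE, div_mul_cancel₀ _ hT0.ne'] at h1
  linarith [min_le_left (q / 2) r]

/-- The Fife-McLeod supersolution: a front with decaying lift and converging phase. -/
lemma IsTravellingFront.exists_supersolution (hg : IsBistable g a)
    (hΦ : IsTravellingFront g c Φ) :
    ∃ β q C : ℝ, 0 < β ∧ 0 < q ∧ ∀ W, IsForward g W → ∀ z : ℝ,
      (∀ i j : ℤ, W i j 0 ≤ Φ (i + z) + q) →
      ∀ (i j : ℤ) (t : ℝ), 0 ≤ t → W i j t ≤ Φ (i - c * t + (z + C)) + q * Real.exp (-β * t) := by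
  obtain ⟨β, δ, hβ, hδ, hδ1, htail⟩ := hg.exists_tailDecay
  obtain ⟨R₀, hR₀⟩ := eventually_atBot.1
    (hΦ.tendsto_atBot.eventually (gt_mem_nhds (half_pos hδ)))
  obtain ⟨R₁, hR₁⟩ := eventually_atTop.1
    (hΦ.tendsto_atTop.eventually (lt_mem_nhds (by linarith : 1 - δ < 1)))
  obtain ⟨B, hB, hLip⟩ := exists_lipschitz_bound hg.contDiff 2
  have hd0 : ∀ ξ, 0 < deriv Φ ξ := hΦ.deriv_pos hg
  obtain ⟨x₀, -, hx₀⟩ := isCompact_Icc.exists_isMinOn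
    (Set.nonempty_Icc.2 (le_max_left R₀ R₁))
    ((hΦ.contDiff.continuous_deriv le_rfl).continuousOn)
  set κ := deriv Φ x₀ with hκ
  have hκ0 : 0 < κ := hd0 x₀
  set C := (B + β) / κ with hC
  have hC0 : 0 < C := by positivity
  -- Since `Φ < δ / 2` on the left tail, a lift of at most `δ / 2` stays where `TailDecay` applies.
  set q := δ / 2 with hq
  have hq0 : 0 < q := half_pos hδ
  refine ⟨β, q, C * (q / β), hβ, hq0, fun W hW z h0 i j t ht => ?_⟩
  -- This is the supersolution inequality for a lift `Q` with `Q' = -β Q` and a phase speed `C * Q`.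
  -- In the tails the decay of `g` pays for `Q'`; in the middle `Φ' ≥ κ`, and `C * κ = B + β` pays
  -- for it and for the variation of `g`.
  have main : ∀ ξ Q, 0 ≤ Q → Q ≤ q → 0 ≤ C * Q * deriv Φ ξ - β * Q + g (Φ ξ) - g (Φ ξ + Q) := by
    intro ξ Q hQ0 hQ
    have hΦI := hΦ.mem_Icc hg ξ
    rw [Set.mem_Icc] at hΦI
    have hnn : 0 ≤ C * Q * deriv Φ ξ := by
      have := hd0 ξ
      positivity
    by_cases hξ : ξ ∈ Set.Icc R₀ (max R₀ R₁)
    · have h1 : κ ≤ deriv Φ ξ := hx₀ hξ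
      have h2 := (abs_le.1 (hLip (Φ ξ) ⟨by linarith, by linarith⟩ (Φ ξ + Q)
        ⟨by linarith, by linarith⟩)).1
      rw [sub_add_cancel_left, abs_neg, abs_of_nonneg hQ0] at h2
      have h3 : C * Q * κ = (B + β) * Q := by
        rw [hC]
        field_simp
      have h4 := mul_le_mul_of_nonneg_left h1 (by positivity : 0 ≤ C * Q)
      linarith
    · have h1 := htail (Φ ξ) (Φ ξ + Q) (by linarith) (by
        rw [Set.mem_Icc, not_and_or, not_le, not_le] at hξ
        rcases hξ with hξ | hξ
        · left
          have := hR₀ ξ hξ.le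
          constructor <;> linarith
        · right
          have := hR₁ ξ ((le_max_right R₀ R₁).trans hξ.le)
          constructor <;> linarith)
      rw [add_sub_cancel_left] at h1
      linarith
  set Q : ℝ → ℝ := fun t => q * Real.exp (-β * t) with hQdef
  -- This phase has derivative `C * Q t` and total drift at most `C * (q / β)`, the constant
  -- announced above.
  set Z : ℝ → ℝ := fun t => z + C * ((q - Q t) / β) with hZdef
  have hQd : ∀ t, HasDerivAt Q (-β * Q t) t := by
    intro t
    have := (((hasDerivAt_id t).const_mul (-β)).exp).const_mul q
    exact this.congr_deriv (by simp only [hQdef, id]; ring)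
  have hZd : ∀ t, HasDerivAt Z (C * Q t) t := by
    intro t
    exact (((((hQd t).const_sub q).div_const β).const_mul C).const_add z).congr_deriv
      (by field_simp)
  have hQ0 : ∀ t, 0 < Q t := fun t => by positivity
  have hQq : ∀ t, 0 ≤ t → Q t ≤ q := fun t ht => by
    have : Real.exp (-β * t) ≤ 1 := Real.exp_le_one_iff.2 (by nlinarith)
    simp only [hQdef]
    nlinarith
  have hVd : ∀ (i : ℤ) (t : ℝ), HasDerivAt (fun t => Φ (i - c * t + Z t) + Q t)
      (deriv Φ (i - c * t + Z t) * (-c + C * Q t) + -β * Q t) t := by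
    intro i t
    have h1 : HasDerivAt (fun t : ℝ => i - c * t) (-c) t := by
      simpa using ((hasDerivAt_id t).const_mul c).const_sub (i : ℝ)
    exact ((hΦ.hasDerivAt _).comp t (h1.add (hZd t))).add (hQd t)
  have hle := hW.le_of_supersolution hg.contDiff (T := t) (M := 2)
    (V := fun i _ t => Φ (i - c * t + Z t) + Q t)
    (V' := fun i _ t => deriv Φ (i - c * t + Z t) * (-c + C * Q t) + -β * Q t)
    (fun i _ s _ => (hVd i s).continuousAt.continuousWithinAt)
    (fun i _ s _ => hVd i s)
    (fun i j s hs => by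
      have h1 := main (i - c * s + Z s) (Q s) (hQ0 s).le (hQq s hs.1.le)
      have h2 := hΦ.wave_eq (i - c * s + Z s)
      have h3 : lap (fun i _ t => Φ (i - c * t + Z t) + Q t) i j s
          = lap (fun i _ t => Φ (i - c * t + Z t)) i j s := by
        simp only [lap]
        ring
      rw [h3, lap_planar Φ (fun i t => (i : ℝ) - c * t + Z t) (fun i t => by push_cast; ring)]
      linarith)
    (fun i _ s hs => by
      have h1 := hΦ.mem_Icc hg (i - c * s + Z s)
      rw [Set.mem_Icc] at h1
      have h2 := hQq s hs.1
      have h3 := hQ0 s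
      rw [abs_le]
      constructor <;> linarith)
    (fun i j => by
      have := h0 i j
      simpa [hQdef, hZdef] using this) i j t ⟨ht, le_rfl⟩
  refine hle.trans (add_le_add (hΦ.monotone hg ?_) le_rfl)
  simp only [hZdef]
  have h1 : (q - Q t) / β ≤ q / β := by
    gcongr
    linarith [hQ0 t]
  have := mul_le_mul_of_nonneg_left h1 hC0.le
  linarith

/-- A solution that starts below the unstable state on the far left eventually stays below a
translate of the front, up to a small error. -/
lemma IsForward.eventually_le (hg : IsBistable g a) (hΦ : IsTravellingFront g c Φ)
    (hW : IsForward g W) {y₀ : ℝ} (hy₀ : y₀ < a) {N : ℝ}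
    (hN : ∀ i j : ℤ, (i : ℝ) ≤ N → W i j 0 ≤ y₀) {ε : ℝ} (hε : 0 < ε) :
    ∃ R T : ℝ, ∀ t, T ≤ t → ∀ i j : ℤ, W i j t ≤ 1 + ε ∧ (i - c * t ≤ -R → W i j t ≤ ε) := by
  obtain ⟨β, q, C, hβ, hq, hsup⟩ := hΦ.exists_supersolution hg
  obtain ⟨T₁, hT₁, h₁⟩ := hW.exists_time_le_one_add hg (half_pos hq)
  obtain ⟨T₂, hT₂, h₂⟩ := hW.exists_time_le_left hg hy₀ hN hq
  set T := max T₁ T₂ with hT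
  have hT0 : 0 < T := hT₁.trans_le (le_max_left _ _)
  obtain ⟨N', hN'⟩ := h₂ T (le_max_right _ _)
  obtain ⟨R₁, hR₁⟩ := eventually_atTop.1
    (hΦ.tendsto_atTop.eventually (lt_mem_nhds (by linarith : 1 - q / 2 < 1)))
  -- At time `T` the lift alone dominates to the left of `N'`; to the right the translate exceeds `1
  -- - q / 2`, so the lifted front exceeds `1 + q / 2`.
  have hle := hsup _ (hW.timeShift hT0.le) (R₁ - N') (fun i j => by
    rw [zero_add]
    rcases le_total (i : ℝ) N' with hi | hi
    · linarith [hN' i j hi, hΦ.pos hg (i + (R₁ - N'))]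
    · linarith [h₁ T (le_max_left _ _) i j, hR₁ (i + (R₁ - N')) (by linarith)])
  have hlim : Tendsto (fun t : ℝ => q * Real.exp (-β * t)) atTop (𝓝 (q * 0)) := by
    refine (Real.tendsto_exp_atBot.comp ?_).const_mul q
    exact tendsto_id.const_mul_atTop_of_neg (neg_lt_zero.2 hβ)
  rw [mul_zero] at hlim
  obtain ⟨T₃, hT₃⟩ := eventually_atTop.1 (hlim.eventually (gt_mem_nhds (half_pos hε)))
  obtain ⟨R₀, hR₀⟩ := eventually_atBot.1
    (hΦ.tendsto_atBot.eventually (gt_mem_nhds (half_pos hε)))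
  refine ⟨-R₀ + (R₁ - N' + C) + |c| * T, T + max T₃ 0, fun t ht i j => ?_⟩
  have hm := le_max_left T₃ 0
  have hm' := le_max_right T₃ 0
  have h3 := hle i j (t - T) (by linarith)
  rw [sub_add_cancel] at h3
  have h4 := hT₃ (t - T) (by linarith)
  refine ⟨?_, fun hi => ?_⟩
  · linarith [hΦ.lt_one hg (i - c * (t - T) + (R₁ - N' + C))]
  · have h5 := hR₀ (i - c * (t - T) + (R₁ - N' + C)) (by
      have := mul_le_mul_of_nonneg_right (le_abs_self c) hT0.le
      linarith)
    linarith

end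

/-! ### Reflection, and convergence to the front near the interface -/

section
variable {g : ℝ → ℝ} {a c : ℝ} {Φ : ℝ → ℝ} {W : ℤ → ℤ → ℝ → ℝ}

/-- The reflection `x ↦ 1 - x`, together with `i ↦ -i`, exchanges the stable states and reverses the
speed, so every upper bound yields a lower one. -/
lemma IsBistable.reflect (hg : IsBistable g a) : IsBistable (fun x => -g (1 - x)) (1 - a) := by
  have hd : ∀ x, deriv (fun x => -g (1 - x)) x = deriv g (1 - x) := fun x => by
    have h1 := (hg.contDiff.differentiable (by norm_num) (1 - x)).hasDerivAt.comp_const_sub 1 x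
    simpa using h1.neg.deriv
  have := hg.a_pos
  have := hg.a_lt_one
  refine ⟨?_, by linarith, by linarith, by simp [hg.map_one], by simp [hg.map_a],
    by simp [hg.map_zero], ?_, ?_, fun x hx => ?_, fun x hx hx' => ?_, fun x hx hx' => ?_,
    fun x hx => ?_⟩
  · exact (hg.contDiff.comp (contDiff_const.sub contDiff_id)).neg
  · rw [hd, sub_zero]
    exact hg.deriv_one_neg
  · rw [hd, sub_self]
    exact hg.deriv_zero_neg
  · exact neg_pos.2 (hg.neg_of_one_lt _ (by linarith))
  · exact neg_lt_zero.2 (hg.pos_of_a_lt _ (by linarith) (by linarith))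
  · exact neg_pos.2 (hg.neg_of_lt_a _ (by linarith) (by linarith))
  · exact neg_lt_zero.2 (hg.pos_of_neg _ (by linarith))

lemma IsTravellingFront.reflect (hΦ : IsTravellingFront g c Φ) :
    IsTravellingFront (fun x => -g (1 - x)) (-c) fun ξ => 1 - Φ (-ξ) := by
  refine ⟨neg_ne_zero.2 hΦ.speed_ne_zero, ?_, ?_, ?_, fun ξ => ?_, ?_⟩
  · exact contDiff_const.sub (hΦ.contDiff.comp contDiff_neg)
  · simpa using (hΦ.tendsto_atTop.comp tendsto_neg_atBot_atTop).const_sub 1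
  · simpa using (hΦ.tendsto_atBot.comp tendsto_neg_atTop_atBot).const_sub 1
  · have hd : deriv (fun ξ => 1 - Φ (-ξ)) ξ = deriv Φ (-ξ) := by
      have h1 := (hΦ.hasDerivAt (-ξ)).comp ξ (hasDerivAt_neg ξ)
      simpa using (h1.const_sub 1).deriv
    have h := hΦ.wave_eq (-ξ)
    have e1 : -(ξ + 1) = -ξ - 1 := by ring
    have e2 : -(ξ - 1) = -ξ + 1 := by ring
    rw [hd, e1, e2, sub_sub_cancel]
    linarith
  · simp only [neg_zero, hΦ.map_zero]
    norm_num

lemma IsForward.reflect (hW : IsForward g W) :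
    IsForward (fun x => -g (1 - x)) fun i j t => 1 - W (-i) j t where
  continuousOn i j := continuousOn_const.sub (hW.continuousOn (-i) j)
  hasDerivAt i j t ht := by
    refine ((hW.hasDerivAt (-i) j t ht).const_sub 1).congr_deriv ?_
    have e1 : -(i + 1) = -i - 1 := by ring
    have e2 : -(i - 1) = -i + 1 := by ring
    simp only [lap, e1, e2, sub_sub_cancel]
    ring
  bounded T := by
    obtain ⟨M, hM⟩ := hW.bounded T
    refine ⟨1 + M, fun i j t ht => (abs_sub _ _).trans ?_⟩
    rw [abs_one]
    linarith [hM (-i) j t ht]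

/-- `W` is eventually close to `0` far behind and to `1` far ahead of the point `c t`. -/
def EventuallyFrontLike (c : ℝ) (W : ℤ → ℤ → ℝ → ℝ) : Prop :=
  ∀ ε, 0 < ε → ∃ R T : ℝ, ∀ t, T ≤ t → ∀ i j : ℤ, -ε ≤ W i j t ∧ W i j t ≤ 1 + ε ∧
    (i - c * t ≤ -R → W i j t ≤ ε) ∧ (R ≤ i - c * t → 1 - ε ≤ W i j t)

lemma IsForward.eventuallyFrontLike (hg : IsBistable g a) (hΦ : IsTravellingFront g c Φ)
    (hW : IsForward g W) {y₀ y₁ N N₁ : ℝ} (hy₀ : y₀ < a)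
    (hN : ∀ i j : ℤ, (i : ℝ) ≤ N → W i j 0 ≤ y₀) (hy₁ : a < y₁)
    (hN₁ : ∀ i j : ℤ, N₁ ≤ (i : ℝ) → y₁ ≤ W i j 0) : EventuallyFrontLike c W := by
  intro ε hε
  obtain ⟨R₀, T₀, h₀⟩ := hW.eventually_le hg hΦ hy₀ hN hε
  obtain ⟨R₁, T₁, h₁⟩ := hW.reflect.eventually_le hg.reflect hΦ.reflect
    (y₀ := 1 - y₁) (by linarith) (N := -N₁) (fun i j hi => by
      have := hN₁ (-i) j (by push_cast; linarith)
      linarith) hε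
  refine ⟨max R₀ R₁, max T₀ T₁, fun t ht i j => ?_⟩
  have a1 := h₀ t ((le_max_left _ _).trans ht) i j
  have a2 := h₁ t ((le_max_right _ _).trans ht) (-i) j
  rw [neg_neg] at a2
  refine ⟨by linarith [a2.1], a1.1, fun h => a1.2 ?_, fun h => ?_⟩
  · linarith [le_max_left R₀ R₁]
  · have := a2.2 (by
      push_cast
      linarith [le_max_right R₀ R₁])
    linarith

/-- Near the interface, a front-like solution converges along any sequence of times tending to
infinity to translates of the travelling front. -/
lemma IsForward.exists_limit_eq_translate (hg : IsBistable g a) (hΦ : IsTravellingFront g c Φ)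
    (hW : IsForward g W) (hfl : EventuallyFrontLike c W) {P Q : ℕ → ℤ} {τ : ℕ → ℝ} {N : ℝ}
    (hτ : Tendsto τ atTop atTop) (hP : ∀ n, |P n - c * τ n| ≤ N) :
    ∃ θ, ∀ i j : ℤ, Tendsto (fun n => W (i + P n) (j + Q n) (τ n)) (hyperfilter ℕ)
      (𝓝 (Φ (i + θ))) := by
  have hτU : Tendsto τ (hyperfilter ℕ) atTop := hτ.mono_left Nat.hyperfilter_le_atTop
  -- The recentred solutions live on half-lines whose left ends tend to `-∞`, so on each fixed
  -- half-line all bounds hold eventually and the limit is entire.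
  have hlarge : ∀ s T : ℝ, ∀ᶠ n in (hyperfilter ℕ : Filter ℕ), ∀ t, s ≤ t → T ≤ t + τ n := by
    intro s T
    filter_upwards [hτU.eventually_ge_atTop (T - s)] with n hn t ht
    linarith
  obtain ⟨R₁, T₁, h₁⟩ := hfl 1 one_pos
  obtain ⟨V, hV, hVM, hVt⟩ := exists_entire_limit (hyperfilter ℕ) hg.contDiff
    (W := fun n i j t => W (i + P n) (j + Q n) (t + τ n)) (M := 2)
    (fun s => by
      filter_upwards [hlarge s T₁] with n hn i j t ht
      have := h₁ _ (hn t ht) (i + P n) (j + Q n)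
      exact abs_le.2 ⟨by linarith [this.1], by linarith [this.2.1]⟩)
    (fun s => by
      filter_upwards [hlarge s 1] with n hn i j t ht
      have := (hW.hasDerivAt (i + P n) (j + Q n) (t + τ n)
        (one_pos.trans_le (hn t ht))).comp_add_const t (τ n)
      simpa only [lap, add_right_comm _ (1 : ℤ), sub_add_eq_add_sub] using this)
  have hρ : ∀ ε : ℝ, ∃ R T : ℝ, 0 < ε → ∀ t, T ≤ t → ∀ i j : ℤ,
      (i - c * t ≤ -R → W i j t ≤ ε) ∧ (R ≤ i - c * t → 1 - ε ≤ W i j t) := by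
    intro ε
    by_cases hε : 0 < ε
    · obtain ⟨R, T, h⟩ := hfl ε hε
      exact ⟨R, T, fun _ t ht i j => (h t ht i j).2.2⟩
    · exact ⟨0, 0, fun h => absurd h hε⟩
  choose R T hRT using hρ
  have hfront : IsFront g c (fun ε => R ε + N) V := by
    refine ⟨hV, hV.mem_Icc hg hVM, fun ε hε i j t ht => ?_, fun ε hε i j t ht => ?_⟩
    · refine le_of_tendsto (hVt i j t) ?_
      filter_upwards [hlarge t (T ε)] with n hn
      refine (hRT ε hε _ (hn t le_rfl) _ _).1 ?_
      have := abs_le.1 (hP n)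
      push_cast
      linarith
    · refine ge_of_tendsto (hVt i j t) ?_
      filter_upwards [hlarge t (T ε)] with n hn
      refine (hRT ε hε _ (hn t le_rfl) _ _).2 ?_
      have := abs_le.1 (hP n)
      push_cast
      linarith
  obtain ⟨θ, hθ⟩ := hfront.exists_eq_translate hg hΦ
  refine ⟨θ, fun i j => ?_⟩
  have := hVt i j 0
  simpa only [hθ, zero_add, mul_zero, sub_zero] using this

/-- Uniform convergence to translates of the front on neighbouring pairs near the interface. -/
lemma IsForward.exists_translate_near (hg : IsBistable g a) (hΦ : IsTravellingFront g c Φ)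
    (hW : IsForward g W) (hfl : EventuallyFrontLike c W) (N : ℝ) {ε : ℝ} (hε : 0 < ε) :
    ∃ T : ℝ, ∀ t, T ≤ t → ∀ i j : ℤ, |i - c * t| ≤ N →
      ∃ θ, |W i j t - Φ θ| ≤ ε ∧ |W (i + 1) j t - Φ (θ + 1)| ≤ ε := by
  by_contra! hcon
  choose τ hτ P Q hP hPQ using fun n : ℕ => hcon n
  obtain ⟨θ, hθ⟩ := hW.exists_limit_eq_translate hg hΦ hfl (Q := Q)
    (tendsto_atTop_mono hτ tendsto_natCast_atTop_atTop) hP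
  have h0 := hθ 0 0
  have h1 := hθ 1 0
  simp only [zero_add, Int.cast_zero, Int.cast_one] at h0 h1
  have e0 := h0.eventually (Metric.closedBall_mem_nhds _ hε)
  have e1 := h1.eventually (Metric.closedBall_mem_nhds _ hε)
  obtain ⟨n, hn0, hn1⟩ := (e0.and e1).exists
  rw [Real.dist_eq] at hn0 hn1
  have := hPQ n θ hn0
  rw [add_comm (P n), add_comm θ] at this
  linarith

/-- For large times, crossing a level strictly inside `(0, 1)` entails a uniform increase. -/
lemma IsForward.exists_increase (hg : IsBistable g a) (hΦ : IsTravellingFront g c Φ)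
    (hW : IsForward g W) (hfl : EventuallyFrontLike c W) :
    ∃ δ T : ℝ, 0 < δ ∧ ∀ t, T ≤ t → ∀ i j : ℤ, ∀ y, Φ (-2) ≤ y → y ≤ Φ 2 → y ≤ W i j t →
      y + δ ≤ W (i + 1) j t := by
  have hmono := hΦ.strictMono hg
  have hc : Continuous Φ := hΦ.contDiff.continuous
  obtain ⟨x₀, -, hx₀⟩ := (isCompact_Icc (a := (-3 : ℝ)) (b := 3)).exists_isMinOn
    (Set.nonempty_Icc.2 (by norm_num))
    (f := fun θ => Φ (θ + 1) - Φ θ) (by fun_prop)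
  set m := Φ (x₀ + 1) - Φ x₀ with hm
  have hm0 : 0 < m := sub_pos.2 (hmono (by linarith))
  have d1 : 0 < Φ (-2) - Φ (-3) := sub_pos.2 (hmono (by norm_num))
  have d2 : 0 < Φ 3 - Φ 2 := sub_pos.2 (hmono (by norm_num))
  have d3 : 0 < 1 - Φ 3 := sub_pos.2 (hΦ.lt_one hg 3)
  have d4 : 0 < Φ (-2) := hΦ.pos hg _
  -- The contradiction below adds three errors of size `δ`, against an increase of at least `m`. The
  -- other two bounds confine `θ` to `[-3, 2]`, where `m` is the least unit increment.
  set δ := min (m / 4) (min ((Φ (-2) - Φ (-3)) / 2) ((Φ 3 - Φ 2) / 2)) with hδ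
  have hδ0 : 0 < δ := by positivity
  have hδ1 : δ ≤ m / 4 := min_le_left _ _
  have hδ2 : δ ≤ (Φ (-2) - Φ (-3)) / 2 := (min_le_right _ _).trans (min_le_left _ _)
  have hδ3 : δ ≤ (Φ 3 - Φ 2) / 2 := (min_le_right _ _).trans (min_le_right _ _)
  obtain ⟨R, T, hRT⟩ := hfl (min (Φ (-2) / 2) (1 - Φ 3)) (by positivity)
  have hε1 := min_le_left (Φ (-2) / 2) (1 - Φ 3)
  have hε2 := min_le_right (Φ (-2) / 2) (1 - Φ 3)
  obtain ⟨T', hT'⟩ := hW.exists_translate_near hg hΦ hfl (|R| + 1) hδ0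
  refine ⟨δ, max T T', hδ0, fun t ht i j y hy hy' hyW => ?_⟩
  by_contra! hlt
  have h1 := (hRT t ((le_max_left _ _).trans ht) i j).2.2.1
  have h2 := (hRT t ((le_max_left _ _).trans ht) (i + 1) j).2.2.2
  have hR := le_abs_self R
  -- A value at least `Φ (-2)` excludes the left tail, and a right neighbour below `y + δ < Φ 3`
  -- excludes the right tail.
  have hi : |(i : ℝ) - c * t| ≤ |R| + 1 := by
    rw [abs_le]
    constructor
    · by_contra! h
      have := h1 (by linarith)
      linarith
    · by_contra! h
      have := h2 (by
        push_cast
        linarith)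
      linarith
  obtain ⟨θ, hθ0, hθ1⟩ := hT' t ((le_max_right _ _).trans ht) i j hi
  rw [abs_le] at hθ0 hθ1
  have b1 : -3 ≤ θ := hmono.le_iff_le.1 (by linarith)
  have b2 : θ + 1 ≤ 3 := hmono.le_iff_le.1 (by linarith)
  have b3 : m ≤ Φ (θ + 1) - Φ θ := hx₀ (Set.mem_Icc.2 ⟨b1, by linarith⟩)
  linarith

/-- For large times, the left neighbour of a value above `1/2` exceeds `Φ (-2)`. -/
lemma IsForward.eventually_lt_left (hg : IsBistable g a) (hΦ : IsTravellingFront g c Φ)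
    (hW : IsForward g W) (hfl : EventuallyFrontLike c W) :
    ∃ T : ℝ, ∀ t, T ≤ t → ∀ i j : ℤ, 1 / 2 < W (i + 1) j t → Φ (-2) < W i j t := by
  have hmono := hΦ.strictMono hg
  have d1 : 0 < Φ (-1) - Φ (-2) := sub_pos.2 (hmono (by norm_num))
  have d2 : 0 < Φ 0 - Φ (-1) := sub_pos.2 (hmono (by norm_num))
  have d3 : 0 < 1 - Φ (-1) := sub_pos.2 (hΦ.lt_one hg _)
  have d4 := hΦ.pos hg (-2)
  have h0 := hΦ.map_zero
  have hIm : Φ (-1 / 2) < Φ 0 := hmono (by norm_num)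
  have hIm' : Φ (-2) < Φ (-3 / 2) := hmono (by norm_num)
  obtain ⟨R, T, hRT⟩ := hfl (min (1 / 2) (1 - Φ (-1))) (by positivity)
  have hε1 := min_le_left (1 / 2) (1 - Φ (-1))
  have hε2 := min_le_right (1 / 2) (1 - Φ (-1))
  -- The second tolerance turns a right neighbour above `Φ 0` into `θ + 1 ≥ -1/2`; the first keeps
  -- the value at `θ ≥ -3/2` above `Φ (-2)`.
  obtain ⟨T', hT'⟩ := hW.exists_translate_near hg hΦ hfl (|R| + 1)
    (ε := min ((Φ (-3 / 2) - Φ (-2)) / 2) (Φ 0 - Φ (-1 / 2)))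
    (lt_min (by linarith) (by linarith))
  have hδ1 := min_le_left ((Φ (-3 / 2) - Φ (-2)) / 2) (Φ 0 - Φ (-1 / 2))
  have hδ2 := min_le_right ((Φ (-3 / 2) - Φ (-2)) / 2) (Φ 0 - Φ (-1 / 2))
  refine ⟨max T T', fun t ht i j hlt => ?_⟩
  by_contra! hle
  have h1 := (hRT t ((le_max_left _ _).trans ht) (i + 1) j).2.2.1
  have h2 := (hRT t ((le_max_left _ _).trans ht) i j).2.2.2
  have hR := le_abs_self R
  have hi : |(i : ℝ) - c * t| ≤ |R| + 1 := by
    rw [abs_le]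
    constructor
    · by_contra! h
      have := h1 (by
        push_cast
        linarith)
      linarith
    · by_contra! h
      have := h2 (by linarith)
      linarith
  obtain ⟨θ, hθ0, hθ1⟩ := hT' t ((le_max_right _ _).trans ht) i j hi
  rw [abs_le] at hθ0 hθ1
  have b1 : -1 / 2 ≤ θ + 1 := hmono.le_iff_le.1 (by linarith)
  have b2 : Φ (-3 / 2) ≤ Φ θ := hmono.monotone (by linarith)
  linarith

end

/-! ### The statement for the given solution -/

lemma IsAllenCahnSolution.isForward {g : ℝ → ℝ} {u₀ : LInfLattice} {u : ℝ → LInfLattice}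
    (hu : IsAllenCahnSolution g u₀ u) : IsForward g fun i j t => u t (i, j) where
  continuousOn i j := ((continuous_apply (i, j)).comp
    lp.uniformContinuous_coe.continuous).comp_continuousOn hu.contDiffOn.continuousOn
  hasDerivAt i j t ht := hu.lattice_eq t ht i j
  bounded T := by
    obtain ⟨M, hM⟩ := isCompact_Icc.exists_bound_of_continuousOn (s := Set.Icc 0 T)
      (hu.contDiffOn.continuousOn.mono Set.Icc_subset_Ici_self)
    exact ⟨M, fun i j t ht => (lp.norm_apply_le_norm ENNReal.top_ne_zero (u t) (i, j)).trans
      (hM t ht)⟩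

lemma IsFrontLike.exists_bounds {a : ℝ} {u₀ : LInfLattice} (h : IsFrontLike a u₀) :
    (∃ y₀ < a, ∃ N : ℝ, ∀ i j : ℤ, (i : ℝ) ≤ N → u₀ (i, j) ≤ y₀) ∧
      ∃ y₁ > a, ∃ N : ℝ, ∀ i j : ℤ, N ≤ (i : ℝ) → y₁ ≤ u₀ (i, j) := by
  have hb : ∀ i j : ℤ, |u₀ (i, j)| ≤ ‖u₀‖ := fun i j =>
    lp.norm_apply_le_norm ENNReal.top_ne_zero u₀ (i, j)
  have hA : ∀ i : ℤ, BddAbove (Set.range fun j : ℤ => u₀ (i, j)) := fun i =>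
    ⟨‖u₀‖, by rintro _ ⟨j, rfl⟩; exact (abs_le.1 (hb i j)).2⟩
  have hB : ∀ i : ℤ, BddBelow (Set.range fun j : ℤ => u₀ (i, j)) := fun i =>
    ⟨-‖u₀‖, by rintro _ ⟨j, rfl⟩; exact (abs_le.1 (hb i j)).1⟩
  constructor
  · obtain ⟨y, hy, hya⟩ := exists_between h.limsup_lt
    have := eventually_lt_of_limsup_lt hy
      (isBoundedUnder_of ⟨‖u₀‖, fun i => ciSup_le fun j => (abs_le.1 (hb i j)).2⟩)
    obtain ⟨N, hN⟩ := eventually_atBot.1 this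
    exact ⟨y, hya, N, fun i j hi => (le_ciSup (hA i) j).trans (hN i (by exact_mod_cast hi)).le⟩
  · obtain ⟨y, hya, hy⟩ := exists_between h.lt_liminf
    have := eventually_lt_of_lt_liminf hy
      (isBoundedUnder_of ⟨-‖u₀‖, fun i => le_ciInf fun j => (abs_le.1 (hb i j)).1⟩)
    obtain ⟨N, hN⟩ := eventually_atTop.1 this
    exact ⟨y, hya, N, fun i j hi => (hN i (by exact_mod_cast hi)).le.trans (ciInf_le (hB i) j)⟩

theorem proposition2p1 (g : ℝ → ℝ) (a : ℝ) (hg : IsBistable g a)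
    (c : ℝ) (Φ : ℝ → ℝ) (hΦ : IsTravellingFront g c Φ)
    (u₀ : LInfLattice) (hu₀ : IsFrontLike a u₀)
    (u : ℝ → LInfLattice) (hu : IsAllenCahnSolution g u₀ u) :
    ∃ T : ℝ, 0 < T ∧
      -- unique crossing of the value `1/2` on every horizontal slice
      (∀ t : ℝ, T ≤ t → ∀ j : ℤ,
        ∃! i : ℤ, (0 < u t (i, j) ∧ u t (i, j) ≤ 1 / 2) ∧ 1 / 2 < u t (i + 1, j)) ∧
      -- the part of the interfacial region below `1/2` meets every horizontal slice
      (∀ t : ℝ, T ≤ t → ∀ j : ℤ, ∃ i : ℤ, Φ (-2) < u t (i, j) ∧ u t (i, j) ≤ 1 / 2) ∧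
      -- uniform strict monotonicity inside the interfacial region
      (∃ δ : ℝ, 0 < δ ∧ ∀ t : ℝ, T ≤ t → ∀ i j : ℤ, (i, j) ∈ interfacialRegion Φ (u t) →
        δ ≤ u t (i + 1, j) - u t (i, j)) ∧
      -- no exit through the lower boundary, no re-entry through the upper boundary
      (∀ t : ℝ, T ≤ t → ∀ i j : ℤ, u t (i, j) ≤ Φ (-2) → u t (i - 1, j) ≤ Φ (-2)) ∧
      (∀ t : ℝ, T ≤ t → ∀ i j : ℤ, Φ 2 ≤ u t (i, j) → Φ 2 ≤ u t (i + 1, j)) := by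
  obtain ⟨⟨y₀, hy₀, N₀, hN₀⟩, y₁, hy₁, N₁, hN₁⟩ := hu₀.exists_bounds
  have hW := hu.isForward
  have hfl := hW.eventuallyFrontLike hg hΦ hy₀ (N := N₀) (N₁ := N₁)
    (by simpa only [hu.initial] using hN₀) hy₁ (by simpa only [hu.initial] using hN₁)
  obtain ⟨δ, T₁, hδ, hinc⟩ := hW.exists_increase hg hΦ hfl
  obtain ⟨T₂, hleft⟩ := hW.eventually_lt_left hg hΦ hfl
  obtain ⟨R, T₃, hnear⟩ := hfl (1 / 4) (by norm_num)
  have hmono := hΦ.strictMono hg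
  have hm2 : Φ (-2) ≤ 1 / 2 := hΦ.map_zero ▸ (hmono (by norm_num : (-2 : ℝ) < 0)).le
  have hp2 : 1 / 2 ≤ Φ 2 := hΦ.map_zero ▸ (hmono (by norm_num : (0 : ℝ) < 2)).le
  have h22 : Φ (-2) ≤ Φ 2 := hm2.trans hp2
  set T := max 1 (max T₁ (max T₂ T₃)) with hT
  have t1 : T₁ ≤ T := (le_max_left _ _).trans (le_max_right _ _)
  have t2 : T₂ ≤ T := ((le_max_left _ _).trans (le_max_right _ _)).trans (le_max_right _ _)
  have t3 : T₃ ≤ T := ((le_max_right _ _).trans (le_max_right _ _)).trans (le_max_right _ _)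
  -- Once above `1/2`, a row stays above it to the right; hence the crossing is unique.
  have hup : ∀ t, T ≤ t → ∀ i j k : ℤ, i ≤ k → 1 / 2 < u t (i, j) → 1 / 2 < u t (k, j) := by
    intro t ht i j k hik hi
    induction k, hik using Int.leInduction with
    | base => exact hi
    | succ k _ ih =>
      have := hinc t (t1.trans ht) k j (1 / 2) hm2 hp2 ih.le
      linarith
  have hex : ∀ t, T ≤ t → ∀ j : ℤ, ∃ i : ℤ, u t (i, j) ≤ 1 / 2 ∧ 1 / 2 < u t (i + 1, j) := by
    intro t ht j
    obtain ⟨n, hn⟩ := exists_int_le (c * t - R)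
    obtain ⟨k, hk⟩ := exists_int_ge (c * t + R)
    have hnl := (hnear t (t3.trans ht) n j).2.2.1 (by linarith)
    have hkl := (hnear t (t3.trans ht) k j).2.2.2 (by linarith)
    -- The crossing is the last site with value at most `1/2`: the left tail supplies such a site,
    -- and the right tail bounds them all.
    obtain ⟨i, hi, hmax⟩ := Int.exists_greatest_of_bdd (P := fun i => u t (i, j) ≤ 1 / 2)
      ⟨k, fun z hz => by
        by_contra! hlt
        have := hup t ht k j z hlt.le (by linarith)
        linarith⟩ ⟨n, by linarith⟩
    refine ⟨i, hi, ?_⟩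
    by_contra! hle
    have := hmax _ hle
    omega
  refine ⟨T, one_pos.trans_le (le_max_left _ _), fun t ht j => ?_, fun t ht j => ?_,
    ⟨δ, hδ, fun t ht i j hij => ?_⟩, fun t ht i j hij => ?_, fun t ht i j hij => ?_⟩
  · obtain ⟨i, hi, hi'⟩ := hex t ht j
    have hpos := (hΦ.pos hg (-2)).trans (hleft t (t2.trans ht) i j hi')
    refine ⟨i, ⟨⟨hpos, hi⟩, hi'⟩, fun k hk => ?_⟩
    rcases lt_trichotomy k i with h | h | h
    · have := hup t ht (k + 1) j i h hk.2
      linarith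
    · exact h
    · have := hup t ht (i + 1) j k h hi'
      linarith [hk.1.2]
  · obtain ⟨i, hi, hi'⟩ := hex t ht j
    exact ⟨i, hleft t (t2.trans ht) i j hi', hi⟩
  · have := hinc t (t1.trans ht) i j (u t (i, j)) hij.1 hij.2 le_rfl
    linarith
  · by_contra! hlt
    have := hinc t (t1.trans ht) (i - 1) j (Φ (-2)) le_rfl h22 hlt.le
    rw [sub_add_cancel] at this
    linarith
  · have := hinc t (t1.trans ht) i j (Φ 2) h22 le_rfl hij
    linarith
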